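/- \textbf{Conventions.} A divided word $x|y||z$ over $\{a,b,c\}$ (a \emph{mode}) is identified with the substitution $\sigma$ of $\{a,b,c\}^*$ with $\sigma(a)=x$, $\sigma(b)=y$, $\sigma(c)=z$; products of substitutions are compositions. Its $j$-th letter-by-letter conjugate is obtained by rotating the word $xyz$ by $j$ letters (first letters move to the end) while the two dividers keep their places. Let $\pi_{x\to y}$ replace $x$ by $y$. The apotomic, apo-syntonic and syntonic projections of $\sigma$ are the two-letter substitutions $$a\mapsto\pi_{b\to c}(\sigma(a)),\ c\mapsto \pi_{b\to c}(\sigma(bc));\qquad b\mapsto\pi_{a\to b}(\sigma(ab)),\ c\mapsto \pi_{a\to b}(\sigma(c));\qquad a\mapsto\pi_{c\to a}(\sigma(ab)),\ b\mapsto \pi_{c\to a}(\sigma(c)).$$ On an ordered two-letter alphabet $x<y$ put $G:(x,y)\mapsto(x,xy)$, $\tilde G:(x,y)\mapsto(x,yx)$, $D:(x,y)\mapsto(yx,y)$, $\tilde D:(x,y)\mapsto(xy,y)$. The \emph{special Sturmian} morphisms are the elements of the monoid generated by $G,\tilde G,D,\tilde D$, and the \emph{special standard} ones those of the monoid generated by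 $G,D$. A projection is \emph{bad} if it is not special Sturmian. A mode is \emph{bad} if at least one of its projections is bad; it is \emph{bad}$^*$ if exactly the syntonic projection is bad, and \emph{bad}$^{**}$ if exactly the apotomic and apo-syntonic projections are bad. A mode that is not bad is \emph{morphic} if it extends to an automorphism of the free group $F_3$ on $a,b,c$, and \emph{good} otherwise. For distinct letters $x,y$ let $E_{xy}$ exchange $x$ and $y$, let $A_{xy}$ map $x\mapsto xy$ and let $P_{xy}$ map $x\mapsto yx$, the other letters being fixed. \textbf{Proposition.} Let $k\ge 0$, $n\ge 1$, and $$v_{k,n}=a^kba\,|\,a^kca\,||\,(a^kba\,a^kca)^{n-1}a^kba\,a^kc .$$ Write $\kappa_j$ for the $j$-th conjugate of $v_{k,n}$, $\beta_i=a^{k+1-i}ba^i$ and $\chi_i=a^{k+1-i}ca^i$. 1. The word of $v_{k,n}$ has $N=2(k+2)(n+1)-1=2n(k+2)+2k+3$ letters, $\kappa_0=v_{k,n}$, $\kappa_{j+N}=\kappa_j$ for all $j$, and $\kappa_0,\dots,\kappa_{N-1}$ are pairwise distinct. They are given by the following table. - For $0\le m<n$, $1\le i\le k+1$: $\kappa_{2m(k+2)+i-1}=\beta_i|\chi_i||(\beta_i\chi_i)^{n-m-1}\beta_i\,(a^{k+1-i}ca^{i-1})(\beta_i\chi_i)^m$.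 - For $0\le m<n$, $0\le i\le k+1$: $\kappa_{(2m+1)(k+2)+i-1}=\chi_i|\beta_i||(\chi_i\beta_i)^{n-m-1}(a^{k+1-i}ca^kba^i)(\chi_i\beta_i)^m$. - For $1\le m\le n$, $0\le i\le k$: $\kappa_{2m(k+2)+i-1}=\beta_i|\chi_i||(\beta_i\chi_i)^{n-m}(a^{k-i}ba^i)\chi_i(\beta_i\chi_i)^{m-1}$. - $\kappa_{2n(k+2)+k}=\mu^*:=ba^{k+1}|ca^kb||(a^{k+1}ca^{k+1}b)^{n-1}a^{k+1}ca^{k+1}$. - For $0\le l\le k$: $\kappa_{2n(k+2)+k+1+l}=\rho_l:=aa^{k-l}ca^l\,|\,a^{k-l}ba^la\,||\,(a^{k-l}ca^laa^{k-l}ba^la)^{n-1}a^{k-l}ca^laa^{k-l}ba^l$. - $\kappa_{N-1}=\mu^{**}:=ca^kb|a^{k+1}c||(a^{k+1}ba^{k+1}c)^{n-1}a^{k+1}ba^{k+1}$. 2. Exactly two of the conjugates are bad, namely $\mu^*$, which is bad$^*$, and $\mu^{**}\neq\mu^*$, which is bad$^{**}$. 3. The segment from $\mu^{**}$ to $\mu^*$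 is morphic: for $0\le j<2n(k+2)+k$ the mode $\kappa_j$ is morphic, and it is a finite product of substitutions $E_{xy},A_{xy},P_{xy}$. In particular $$v_{k,n}=P_{ba}^kP_{ca}^kA_{ba}P_{ac}(P_{cb}P_{ca})^{n-1}P_{cb}E_{ab}.$$ 4. The opposite segment is good: each of the $k+1$ modes $\kappa_j$ with $2n(k+2)+k<j<N-1$ (that is, $\rho_0,\dots,\rho_k$) is good; in particular it is not an automorphism of $F_3$. 5. The apotomic and apo-syntonic projections of $v_{k,n}$ are special standard. Moreover $\rho_0=\gamma_{k,n}:=a^{k+1}c|a^kba||(a^kca^{k+1}ba)^{n-1}a^kca^{k+1}b$, and its syntonic projection is special standard. 6. All good modes come from $\gamma_{0,n}$: for $0\le l\le k$, $$\rho_l=P_{ca}^{k-l}P_{ba}^{k-l}A_{ca}^{l}A_{ba}^{l}\,\gamma_{0,n}.$$ There are no substitution $\tau$ and no $X$ among the $A_{xy},P_{xy}$ with $\gamma_{0,n}=X\tau$. Moreover there is no other way to generate the good modes: if $\rho_l=F\tau$ with $F$ a finite product of substitutions $A_{xy},P_{xy}$ and $\tau$ any substitution of $\{a,b,c\}^*$,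 then $F=P_{ca}^{p}P_{ba}^{q}A_{ca}^{r}A_{ba}^{s}$ and $\tau=P_{ca}^{k-l-p}P_{ba}^{k-l-q}A_{ca}^{l-r}A_{ba}^{l-s}\gamma_{0,n}$ for some $0\le p,q\le k-l$ and $0\le r,s\le l$. -/

import Mathlib

/-! Modes and substitutions on three letters, their letter-by-letter conjugates and their
two-letter projections. A divided word `x | y || z` is identified with the substitution
`σ` such that `σ(a) = x`, `σ(b) = y`, `σ(c) = z`. -/

namespace PWWF

/-- The three-letter alphabet `{a, b, c}`. -/
inductive Letter
  | a
  | b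
  | c
  deriving DecidableEq

/-- An ordered two-letter alphabet; `lo` and `hi` are its first and its second letter. -/
inductive Two
  | lo
  | hi
  deriving DecidableEq

/-- Words over `{a, b, c}`. -/
abbrev Word := FreeMonoid Letter

/-- Substitutions of `{a, b, c}*`; the product is composition, `(f * g) w = f (g w)`. -/
abbrev Subst := Monoid.End Word

/-- Substitutions of the free monoid on a two-letter alphabet. -/
abbrev Subst2 := Monoid.End (FreeMonoid Two)

/-- The one-letter word `a`. -/
def wa : Word := FreeMonoid.of Letter.a

/-- The one-letter word `b`. -/
def wb : Word := FreeMonoid.of Letter.b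

/-- The one-letter word `c`. -/
def wc : Word := FreeMonoid.of Letter.c

/-- The substitution given by the divided word `x | y || z`. -/
def triple (x y z : Word) : Subst :=
  FreeMonoid.lift fun t => match t with
    | Letter.a => x
    | Letter.b => y
    | Letter.c => z

/-- The undivided word `σ(a) σ(b) σ(c)` of a mode. -/
def modeWord (σ : Subst) : Word := σ (wa * wb * wc)

/-- The `j`-th letter-by-letter conjugate of `x | y || z`: the word `x y z` is rotated `j` times by
one letter (the first letter is moved to the end), while the two dividers keep their places. -/
def conj (σ : Subst) (j : ℕ) : Subst :=
  let w : List Letter := (FreeMonoid.toList (modeWord σ)).rotate j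
  let p := (σ wa).length
  let q := (σ wb).length
  triple (FreeMonoid.ofList (w.take p)) (FreeMonoid.ofList ((w.drop p).take q))
    (FreeMonoid.ofList (w.drop (p + q)))

/-! ### Special Sturmian morphisms -/

/-- The substitution of the two-letter monoid with `lo ↦ u` and `hi ↦ v`. -/
def pair (u v : FreeMonoid Two) : Subst2 :=
  FreeMonoid.lift fun t => match t with
    | Two.lo => u
    | Two.hi => v

/-- The word `lo`. -/
def wlo : FreeMonoid Two := FreeMonoid.of Two.lo

/-- The word `hi`. -/
def whi : FreeMonoid Two := FreeMonoid.of Two.hi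

/-- `G : lo ↦ lo, hi ↦ lo hi`. -/
def G : Subst2 := pair wlo (wlo * whi)

/-- `G~ : lo ↦ lo, hi ↦ hi lo`. -/
def Gt : Subst2 := pair wlo (whi * wlo)

/-- `D : lo ↦ hi lo, hi ↦ hi`. -/
def D : Subst2 := pair (whi * wlo) whi

/-- `D~ : lo ↦ lo hi, hi ↦ hi`. -/
def Dt : Subst2 := pair (wlo * whi) whi

/-- Special Sturmian morphisms: the monoid generated by `G, G~, D, D~`. -/
def IsSpecialSturmian (f : Subst2) : Prop :=
  f ∈ Submonoid.closure ({G, Gt, D, Dt} : Set Subst2)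

/-- Special standard morphisms: the monoid generated by `G, D`. -/
def IsSpecialStandard (f : Subst2) : Prop :=
  f ∈ Submonoid.closure ({G, D} : Set Subst2)

/-! ### The three projections -/

/-- `π_{b → c}`, with values in the words over `{a, c}` (`lo = a`, `hi = c`). -/
def projBC : Word →* FreeMonoid Two :=
  FreeMonoid.map fun t => match t with
    | Letter.a => Two.lo
    | Letter.b => Two.hi
    | Letter.c => Two.hi

/-- `π_{a → b}`, with values in the words over `{b, c}` (`lo = b`, `hi = c`). -/
def projAB : Word →* FreeMonoid Two :=
  FreeMonoid.map fun t => match t with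
    | Letter.a => Two.lo
    | Letter.b => Two.lo
    | Letter.c => Two.hi

/-- `π_{c → a}`, with values in the words over `{a, b}` (`lo = a`, `hi = b`). -/
def projCA : Word →* FreeMonoid Two :=
  FreeMonoid.map fun t => match t with
    | Letter.a => Two.lo
    | Letter.b => Two.hi
    | Letter.c => Two.lo

/-- The apotomic projection `π_{b → c}(σ)`: `a ↦ π_{b → c}(σ(a))`, `c ↦ π_{b → c}(σ(bc))`. -/
def apotomic (σ : Subst) : Subst2 := pair (projBC (σ wa)) (projBC (σ (wb * wc)))

/-- The apo-syntonic projection `π_{a → b}(σ)`: `b ↦ π_{a → b}(σ(ab))`, `c ↦ π_{a → b}(σ(c))`. -/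
def apoSyntonic (σ : Subst) : Subst2 := pair (projAB (σ (wa * wb))) (projAB (σ wc))

/-- The syntonic projection `π_{c → a}(σ)`: `a ↦ π_{c → a}(σ(ab))`, `b ↦ π_{c → a}(σ(c))`. -/
def syntonic (σ : Subst) : Subst2 := pair (projCA (σ (wa * wb))) (projCA (σ wc))

/-- Authentic pairwise well-formed substitutions. -/
def IsPWWF (σ : Subst) : Prop :=
  IsSpecialSturmian (apotomic σ) ∧ IsSpecialSturmian (apoSyntonic σ) ∧
    IsSpecialSturmian (syntonic σ)

/-! ### Automorphisms of the free group of rank three -/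

/-- The embedding of words into the free group on `a, b, c`. -/
def toFreeGroup : Word →* FreeGroup Letter := FreeMonoid.lift FreeGroup.of

/-- The endomorphism of the free group on `a, b, c` that extends a substitution. -/
def extend (σ : Subst) : FreeGroup Letter →* FreeGroup Letter :=
  FreeGroup.lift fun t => toFreeGroup (σ (FreeMonoid.of t))

/-- Morphic: an authentic PWWF substitution that is a (positive) automorphism of `F₃`. -/
def IsMorphic (σ : Subst) : Prop := IsPWWF σ ∧ Function.Bijective (extend σ)

/-- Good, as opposed to morphic and to bad: an authentic PWWF substitution that is not an
automorphism of `F₃`. -/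
def IsGood (σ : Subst) : Prop := IsPWWF σ ∧ ¬ IsMorphic σ

/-- Bad: at least one of the three projections is not special Sturmian. -/
def IsBad (σ : Subst) : Prop := ¬ IsPWWF σ

/-- `bad*`: exactly the syntonic projection is bad. -/
def IsBadStar (σ : Subst) : Prop :=
  IsSpecialSturmian (apotomic σ) ∧ IsSpecialSturmian (apoSyntonic σ) ∧
    ¬ IsSpecialSturmian (syntonic σ)

/-- `bad**`: exactly the apotomic and the apo-syntonic projections are bad. -/
def IsBadStarStar (σ : Subst) : Prop :=
  ¬ IsSpecialSturmian (apotomic σ) ∧ ¬ IsSpecialSturmian (apoSyntonic σ) ∧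
    IsSpecialSturmian (syntonic σ)

/-- `E_{xy}` exchanges the letters `x` and `y`. -/
def E (x y : Letter) : Subst := FreeMonoid.map (Equiv.swap x y)

/-- `A_{xy} : x ↦ xy`, the other letters being fixed. -/
def A (x y : Letter) : Subst :=
  FreeMonoid.lift fun t =>
    if t = x then FreeMonoid.of x * FreeMonoid.of y else FreeMonoid.of t

/-- `P_{xy} : x ↦ yx`, the other letters being fixed. -/
def P (x y : Letter) : Subst :=
  FreeMonoid.lift fun t =>
    if t = x then FreeMonoid.of y * FreeMonoid.of x else FreeMonoid.of t

/-- The letter permutations `E_{xy}`, `x ≠ y`. -/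
def transpositions : Set Subst := {f | ∃ x y : Letter, x ≠ y ∧ f = E x y}

/-- The productions `A_{xy}` and `P_{xy}`, `x ≠ y`. -/
def productions : Set Subst := {f | ∃ x y : Letter, x ≠ y ∧ (f = A x y ∨ f = P x y)}

/-! ### The modes of the table -/

/-- `v_{k,n} = a^k b a | a^k c a || (a^k b a a^k c a)^{n-1} a^k b a a^k c`. -/
def v (k n : ℕ) : Subst :=
  triple (wa ^ k * wb * wa) (wa ^ k * wc * wa)
    ((wa ^ k * wb * wa * (wa ^ k * wc * wa)) ^ (n - 1) * (wa ^ k * wb * wa) * (wa ^ k * wc))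

/-- The number `2 (k + 2) (n + 1) - 1` of letters of `v_{k,n}`. -/
def size (k n : ℕ) : ℕ := 2 * (k + 2) * (n + 1) - 1

/-- `β_i = a^{k+1-i} b a^i`, for `i ≤ k + 1`. -/
def bBlock (k i : ℕ) : Word := wa ^ (k + 1 - i) * wb * wa ^ i

/-- `χ_i = a^{k+1-i} c a^i`, for `i ≤ k + 1`. -/
def cBlock (k i : ℕ) : Word := wa ^ (k + 1 - i) * wc * wa ^ i

/-- `β_i | χ_i || (β_i χ_i)^{n-m-1} β_i (a^{k+1-i} c a^{i-1}) (β_i χ_i)^m`,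
for `m < n` and `1 ≤ i ≤ k + 1`. -/
def rowB (k n m i : ℕ) : Subst :=
  triple (bBlock k i) (cBlock k i)
    ((bBlock k i * cBlock k i) ^ (n - m - 1) * bBlock k i * (wa ^ (k + 1 - i) * wc * wa ^ (i - 1)) *
      (bBlock k i * cBlock k i) ^ m)

/-- `χ_i | β_i || (χ_i β_i)^{n-m-1} (a^{k+1-i} c a^k b a^i) (χ_i β_i)^m`,
for `m < n` and `i ≤ k + 1`. -/
def rowC (k n m i : ℕ) : Subst :=
  triple (cBlock k i) (bBlock k i)
    ((cBlock k i * bBlock k i) ^ (n - m - 1) * (wa ^ (k + 1 - i) * wc * wa ^ k * wb * wa ^ i) *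
      (cBlock k i * bBlock k i) ^ m)

/-- `β_i | χ_i || (β_i χ_i)^{n-m} (a^{k-i} b a^i) χ_i (β_i χ_i)^{m-1}`,
for `1 ≤ m ≤ n` and `i ≤ k`. -/
def rowB' (k n m i : ℕ) : Subst :=
  triple (bBlock k i) (cBlock k i)
    ((bBlock k i * cBlock k i) ^ (n - m) * (wa ^ (k - i) * wb * wa ^ i) * cBlock k i *
      (bBlock k i * cBlock k i) ^ (m - 1))

/-- `b a^{k+1} | c a^k b || (a^{k+1} c a^{k+1} b)^{n-1} a^{k+1} c a^{k+1}`. -/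
def badStar (k n : ℕ) : Subst :=
  triple (wb * wa ^ (k + 1)) (wc * wa ^ k * wb)
    ((wa ^ (k + 1) * wc * wa ^ (k + 1) * wb) ^ (n - 1) * (wa ^ (k + 1) * wc * wa ^ (k + 1)))

/-- `a a^{k-l} c a^l | a^{k-l} b a^l a || (a^{k-l} c a^l a a^{k-l} b a^l a)^{n-1}
a^{k-l} c a^l a a^{k-l} b a^l`, for `l ≤ k`. -/
def goodRow (k n l : ℕ) : Subst :=
  triple (wa * wa ^ (k - l) * wc * wa ^ l) (wa ^ (k - l) * wb * wa ^ l * wa)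
    ((wa ^ (k - l) * wc * wa ^ l * wa * wa ^ (k - l) * wb * wa ^ l * wa) ^ (n - 1) *
      (wa ^ (k - l) * wc * wa ^ l * wa * wa ^ (k - l) * wb * wa ^ l))

/-- `c a^k b | a^{k+1} c || (a^{k+1} b a^{k+1} c)^{n-1} a^{k+1} b a^{k+1}`. -/
def badStarStar (k n : ℕ) : Subst :=
  triple (wc * wa ^ k * wb) (wa ^ (k + 1) * wc)
    ((wa ^ (k + 1) * wb * wa ^ (k + 1) * wc) ^ (n - 1) * (wa ^ (k + 1) * wb * wa ^ (k + 1)))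

/-- `γ_{k,n} = a^{k+1} c | a^k b a || (a^k c a^{k+1} b a)^{n-1} a^k c a^{k+1} b`. -/
def γ (k n : ℕ) : Subst :=
  triple (wa ^ (k + 1) * wc) (wa ^ k * wb * wa)
    ((wa ^ k * wc * wa ^ (k + 1) * wb * wa) ^ (n - 1) * (wa ^ k * wc * wa ^ (k + 1) * wb))

/-- `P_{ca}^p P_{ba}^q A_{ca}^r A_{ba}^s`. -/
def padding (p q r s : ℕ) : Subst :=
  P Letter.c Letter.a ^ p * P Letter.b Letter.a ^ q * A Letter.c Letter.a ^ r *
    A Letter.b Letter.a ^ s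

end PWWF

/-!
The word of `v_{k,n}` is `(β χ)^n β a^k c` with `β = a^k b a` and `χ = a^k c a`. Its period
`β χ` is conjugate to each `β_i χ_i` and `χ_i β_i`, so a rotation is read off from a splitting of
the word into a prefix and a suffix (`conj_eq_triple`, `pow_mul_of_semiconj`). The number of
letters is `-1` modulo `n + 1`, the number of letters `c`; since a rotation by one letter lowers the
sum of the positions of `c` by `n + 1` modulo the length, the rotations are distinct
(`rotate_injOn_of_coprime_count`).

Every projection that is not bad maps `lo` to a block `x = lo^r hi lo^i` and `hi` to `x^p y x^q`,
where `y` is `x` without its first or its last letter. Such a substitution is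
`G^r G~^j D G^p G~^q`, or the same with `D~` in place of `D`
(`isSpecialSturmian_pair_right`, `isSpecialSturmian_pair_left`). On the other hand, a special
Sturmian `f` satisfies `f(lo hi) = p lo hi q` and `f(hi lo) = p hi lo q` for some words `p` and
`q`, so it cannot map `lo` to a word starting with `hi` and `hi` to a word starting with `lo`
(`not_isSpecialSturmian_pair`); the projections of the two bad modes do just that.

A mode of the morphic segment is turned, by removing letters `a` around `b` and `c` and two more
productions, into a permutation of a substitution that fixes `a` and `b` and surrounds `c` by
words over `{a, b}` (`triple_mem_elementary`). The good modes are `γ_{0,n}` with letters `a`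
attached around `b` and `c`. That `γ_{0,n}` is not an automorphism of the free group is shown by an
action on `ℤ` in which the whole image of `γ_{0,n}` fixes `0`, while `a` does not
(`integerAction`, `not_bijective_extend_γ_zero`).

A word in the image of `A_{xy}` or `P_{xy}` that contains `x` contains `y`, it does not end with
`x` in the first case, and it does not start with `x` in the second. For a padded `γ_{0,n}` these
conditions leave only the productions that put an `a` there (`eq_padding_of_paddedγ_eq_mul`), and
as productions are injective they can be cancelled one after the other.
-/

namespace PWWF

/-! ### Powers in a monoid -/

section Monoid

variable {M : Type*} [Monoid M]

theorem pow_mul_of_semiconj {x y z : M} (h : z * x = x * y) (n : ℕ) : z ^ n * x = x * y ^ n :=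
  ((SemiconjBy.pow_right (show SemiconjBy x y z from h.symm) n).eq).symm

theorem pow_mul_pow_mul (x y : M) (m n : ℕ) : x ^ m * (x ^ n * y) = x ^ (m + n) * y := by
  rw [← mul_assoc, pow_add]

theorem mul_pow_mul (x y : M) (n : ℕ) : x * (x ^ n * y) = x ^ (n + 1) * y := by
  rw [← mul_assoc, pow_succ']

theorem mul_pow_mul_comm (x y : M) (n : ℕ) : (y * x) ^ n * y = y * (x * y) ^ n :=
  pow_mul_of_semiconj (mul_assoc _ _ _) n

end Monoid

/-! ### Substitutions given by their values -/

@[simp] theorem triple_wa (x y z : Word) : triple x y z wa = x := rfl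

@[simp] theorem triple_wb (x y z : Word) : triple x y z wb = y := rfl

@[simp] theorem triple_wc (x y z : Word) : triple x y z wc = z := rfl

@[simp] theorem pair_wlo (x y : FreeMonoid Two) : pair x y wlo = x := rfl

@[simp] theorem pair_whi (x y : FreeMonoid Two) : pair x y whi = y := rfl

theorem subst_ext {f g : Subst} (ha : f wa = g wa) (hb : f wb = g wb) (hc : f wc = g wc) :
    f = g :=
  FreeMonoid.hom_eq fun t => by cases t <;> assumption

theorem subst2_ext {f g : Subst2} (hlo : f wlo = g wlo) (hhi : f whi = g whi) : f = g :=
  FreeMonoid.hom_eq fun t => by cases t <;> assumption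

theorem mul_triple (f : Subst) (x y z : Word) : f * triple x y z = triple (f x) (f y) (f z) :=
  subst_ext rfl rfl rfl

theorem mul_pair (f : Subst2) (x y : FreeMonoid Two) : f * pair x y = pair (f x) (f y) :=
  subst2_ext rfl rfl

/-! ### Special Sturmian morphisms -/

theorem G_pow (p : ℕ) : G ^ p = pair wlo (wlo ^ p * whi) := by
  induction p with
  | zero => exact subst2_ext rfl rfl
  | succ p ih =>
    rw [pow_succ, ih, G, mul_pair]
    simp [pow_succ', mul_assoc]

theorem Gt_pow (p : ℕ) : Gt ^ p = pair wlo (whi * wlo ^ p) := by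
  induction p with
  | zero => exact subst2_ext rfl rfl
  | succ p ih =>
    rw [pow_succ, ih, Gt, mul_pair]
    simp [pow_succ, mul_assoc]

theorem pair_mul_G_pow_mul_Gt_pow (x y : FreeMonoid Two) (p q : ℕ) :
    pair x y * (G ^ p * Gt ^ q) = pair x (x ^ p * y * x ^ q) := by
  rw [G_pow, Gt_pow, mul_pair, mul_pair]
  simp

theorem G_pow_mul_Gt_pow_mul_D (r i : ℕ) :
    G ^ r * Gt ^ i * D = pair (wlo ^ r * whi * wlo ^ (i + 1)) (wlo ^ r * whi * wlo ^ i) := by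
  rw [G_pow, Gt_pow, D, mul_pair, mul_pair]
  simp [pow_succ, mul_assoc]

theorem G_pow_mul_Gt_pow_mul_Dt (r i : ℕ) :
    G ^ r * Gt ^ i * Dt = pair (wlo ^ (r + 1) * whi * wlo ^ i) (wlo ^ r * whi * wlo ^ i) := by
  rw [G_pow, Gt_pow, Dt, mul_pair, mul_pair]
  simp [pow_succ', mul_assoc]

theorem isSpecialSturmian_G : IsSpecialSturmian G := Submonoid.subset_closure (by simp)

theorem isSpecialSturmian_Gt : IsSpecialSturmian Gt := Submonoid.subset_closure (by simp)

theorem isSpecialSturmian_D : IsSpecialSturmian D := Submonoid.subset_closure (by simp)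

theorem isSpecialSturmian_Dt : IsSpecialSturmian Dt := Submonoid.subset_closure (by simp)

/-- The first of the two shapes taken by the projections that are not bad: the defective
block lacks its last letter. It is `G ^ r * Gt ^ i * D * (G ^ p * Gt ^ q)`. -/
theorem isSpecialSturmian_pair_right (r i p q : ℕ) {x y z : FreeMonoid Two}
    (hx : x = wlo ^ r * whi * wlo ^ (i + 1)) (hy : y = wlo ^ r * whi * wlo ^ i)
    (hz : z = x ^ p * y * x ^ q) : IsSpecialSturmian (pair x z) := by
  rw [hz, ← pair_mul_G_pow_mul_Gt_pow, hx, hy, ← G_pow_mul_Gt_pow_mul_D]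
  exact mul_mem (mul_mem (mul_mem (pow_mem isSpecialSturmian_G _) (pow_mem isSpecialSturmian_Gt _))
    isSpecialSturmian_D) (mul_mem (pow_mem isSpecialSturmian_G _) (pow_mem isSpecialSturmian_Gt _))

/-- The second shape taken by the projections that are not bad: the defective block lacks
its first letter. -/
theorem isSpecialSturmian_pair_left (r i p q : ℕ) {x y z : FreeMonoid Two}
    (hx : x = wlo ^ (r + 1) * whi * wlo ^ i) (hy : y = wlo ^ r * whi * wlo ^ i)
    (hz : z = x ^ p * y * x ^ q) : IsSpecialSturmian (pair x z) := by
  rw [hz, ← pair_mul_G_pow_mul_Gt_pow, hx, hy, ← G_pow_mul_Gt_pow_mul_Dt]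
  exact mul_mem (mul_mem (mul_mem (pow_mem isSpecialSturmian_G _) (pow_mem isSpecialSturmian_Gt _))
    isSpecialSturmian_Dt) (mul_mem (pow_mem isSpecialSturmian_G _) (pow_mem isSpecialSturmian_Gt _))

/-- The second shape with the defective block written last. -/
theorem isSpecialSturmian_pair_shift (r i q : ℕ) {x y z : FreeMonoid Two}
    (hy : y = wlo ^ r * whi * wlo ^ i) (hx : x = wlo * y) (hz : z = (y * wlo) ^ q * y) :
    IsSpecialSturmian (pair x z) := by
  refine isSpecialSturmian_pair_left r i 0 q ?_ hy ?_
  · rw [hx, hy]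
    simp only [pow_succ', mul_assoc]
  · rw [hz, hx, pow_zero, one_mul, mul_pow_mul_comm]

theorem isSpecialStandard_pair (r p : ℕ) {x y z : FreeMonoid Two}
    (hx : x = wlo ^ r * whi * wlo) (hy : y = wlo ^ r * whi)
    (hz : z = x ^ p * y) : IsSpecialStandard (pair x z) := by
  have h := pair_mul_G_pow_mul_Gt_pow x y p 0
  have h' := G_pow_mul_Gt_pow_mul_D r 0
  simp only [pow_zero, mul_one, zero_add, pow_one] at h h'
  rw [hz, ← h, hx, hy, ← h']
  have hG : IsSpecialStandard G := Submonoid.subset_closure (by simp)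
  have hD : IsSpecialStandard D := Submonoid.subset_closure (by simp)
  exact mul_mem (mul_mem (pow_mem hG _) hD) (pow_mem hG _)

/-- The images of `lo hi` and `hi lo` under a special Sturmian morphism arise from these two words
by the same padding. -/
theorem IsSpecialSturmian.exists_padding {f : Subst2} (hf : IsSpecialSturmian f) :
    ∃ p q, f (wlo * whi) = p * (wlo * whi) * q ∧ f (whi * wlo) = p * (whi * wlo) * q := by
  induction hf using Submonoid.closure_induction_left with
  | one => exact ⟨1, 1, by simp, by simp⟩
  | mul_left g hg f _ ih =>
    obtain ⟨p, q, h₁, h₂⟩ := ih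
    have key : ∃ p q, g (wlo * whi) = p * (wlo * whi) * q ∧
        g (whi * wlo) = p * (whi * wlo) * q := by
      rcases hg with rfl | rfl | rfl | rfl
      · exact ⟨wlo, 1, rfl, rfl⟩
      · exact ⟨1, wlo, rfl, rfl⟩
      · exact ⟨whi, 1, rfl, rfl⟩
      · exact ⟨1, whi, rfl, rfl⟩
    obtain ⟨p', q', h₁', h₂'⟩ := key
    refine ⟨g p * p', q' * g q, ?_, ?_⟩
    · rw [show (g * f) (wlo * whi) = g (f (wlo * whi)) from rfl, h₁, map_mul, map_mul, h₁']
      simp only [mul_assoc]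
    · rw [show (g * f) (whi * wlo) = g (f (whi * wlo)) from rfl, h₂, map_mul, map_mul, h₂']
      simp only [mul_assoc]

/-- The criterion for bad projections: `lo` and `hi` cannot be mapped to words that start with `hi`
and `lo`, respectively. -/
theorem not_isSpecialSturmian_pair (x y : FreeMonoid Two) :
    ¬ IsSpecialSturmian (pair (whi * x) (wlo * y)) := by
  intro h
  obtain ⟨p, q, h₁, h₂⟩ := h.exists_padding
  rw [map_mul, pair_wlo, pair_whi] at h₁ h₂
  cases p with
  | one =>
    -- With an empty left padding the image of `lo hi` starts with `lo`, and not with `hi`.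
    have := congrArg (fun w => (FreeMonoid.toList w).head?) h₁
    simp [whi, wlo, FreeMonoid.toList_mul] at this
  | of_mul t p =>
    -- Both images start with the first letter of the left padding.
    have h₁ := congrArg (fun w => (FreeMonoid.toList w).head?) h₁
    have h₂ := congrArg (fun w => (FreeMonoid.toList w).head?) h₂
    simp [whi, wlo, FreeMonoid.toList_mul] at h₁ h₂
    rw [← h₂] at h₁
    cases h₁

/-! ### The table of conjugates -/

theorem length_pow (w : Word) (n : ℕ) : (w ^ n).length = n * w.length := by
  induction n with
  | zero => simp
  | succ n ih => rw [pow_succ, FreeMonoid.length_mul, ih]; ring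

theorem length_wa : wa.length = 1 := rfl

theorem length_wb : wb.length = 1 := rfl

theorem length_wc : wc.length = 1 := rfl

/-- To rotate the word of a mode by `j` letters is to exchange its prefix of length `j` with the
complementary suffix. -/
theorem conj_eq_triple {σ : Subst} {x y z : Word} (u w : Word) {j : ℕ} (hj : u.length = j)
    (hσ : modeWord σ = u * w) (hx : (σ wa).length = x.length) (hy : (σ wb).length = y.length)
    (h : w * u = x * y * z) : conj σ j = triple x y z := by
  have hrot : (FreeMonoid.toList (modeWord σ)).rotate j
      = FreeMonoid.toList x ++ (FreeMonoid.toList y ++ FreeMonoid.toList z) := by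
    rw [hσ, ← hj, FreeMonoid.toList_mul]
    refine (List.rotate_append_length_eq _ _).trans ?_
    rw [← FreeMonoid.toList_mul, h, mul_assoc]
    rfl
  simp only [conj]
  rw [hrot, hx, hy]
  simp only [FreeMonoid.length]
  rw [List.take_left, List.drop_left, List.take_left, ← List.drop_drop, List.drop_left,
    List.drop_left]
  rfl

/-- The period `a^k b a a^k c a` of the word of `v k n`. -/
def period (k : ℕ) : Word := wa ^ k * wb * wa * (wa ^ k * wc * wa)

theorem modeWord_v (k n : ℕ) :
    modeWord (v k (n + 1)) = period k ^ (n + 1) * (wa ^ k * wb * wa) * (wa ^ k * wc) := by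
  simp only [modeWord, v, map_mul, triple_wa, triple_wb, triple_wc, Nat.add_sub_cancel]
  rw [pow_succ' (period k)]
  simp only [period, mul_assoc]

theorem length_period (k : ℕ) : (period k).length = 2 * (k + 2) := by
  simp only [period, FreeMonoid.length_mul, length_pow, length_wa, length_wb, length_wc]
  ring

theorem length_modeWord_v (k n : ℕ) (hn : 0 < n) : (modeWord (v k n)).length = size k n := by
  obtain ⟨n, rfl⟩ : ∃ t, n = t + 1 := ⟨n - 1, by omega⟩
  simp only [modeWord_v, FreeMonoid.length_mul, length_pow, length_period, length_wa, length_wb,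
    length_wc, size]
  have : 2 * (k + 2) * (n + 1 + 1) = (n + 1) * (2 * (k + 2)) + 2 * (k + 2) := by ring
  omega

theorem size_eq (k n : ℕ) : size k n = 2 * n * (k + 2) + 2 * k + 3 := by
  have : 2 * (k + 2) * (n + 1) = 2 * n * (k + 2) + 2 * k + 4 := by ring
  simp only [size]
  omega

theorem length_v_wa (k n : ℕ) : (v k n wa).length = k + 2 := by
  simp [v, FreeMonoid.length_mul, length_pow, length_wa, length_wb]

theorem length_v_wb (k n : ℕ) : (v k n wb).length = k + 2 := by
  simp [v, FreeMonoid.length_mul, length_pow, length_wa, length_wc]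

theorem length_bBlock {k i : ℕ} (hi : i ≤ k + 1) : (bBlock k i).length = k + 2 := by
  simp only [bBlock, FreeMonoid.length_mul, length_pow, length_wa, length_wb]
  omega

theorem length_cBlock {k i : ℕ} (hi : i ≤ k + 1) : (cBlock k i).length = k + 2 := by
  simp only [cBlock, FreeMonoid.length_mul, length_pow, length_wa, length_wc]
  omega

theorem conj_v_rowB {k n m i : ℕ} (hm : m < n) (hi : 1 ≤ i) (hik : i ≤ k + 1) :
    conj (v k n) (2 * m * (k + 2) + i - 1) = rowB k n m i := by
  obtain ⟨t, rfl⟩ : ∃ t, n = m + t + 1 := ⟨n - m - 1, by omega⟩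
  obtain ⟨i, rfl⟩ : ∃ t, i = t + 1 := ⟨i - 1, by omega⟩
  obtain ⟨r, rfl⟩ : ∃ t, k = t + i := ⟨k - i, by omega⟩
  have hβ : bBlock (r + i) (i + 1) = wa ^ r * wb * wa ^ (i + 1) := by
    rw [bBlock, show r + i + 1 - (i + 1) = r by omega]
  have hχ : cBlock (r + i) (i + 1) = wa ^ r * wc * wa ^ (i + 1) := by
    rw [cBlock, show r + i + 1 - (i + 1) = r by omega]
  have hs (s : ℕ) := pow_mul_of_semiconj (z := period (r + i)) (x := wa ^ i)
    (y := bBlock (r + i) (i + 1) * cBlock (r + i) (i + 1)) (by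
      rw [hβ, hχ, period]
      simp only [mul_assoc, pow_mul_pow_mul, mul_pow_mul, ← pow_succ']
      ring_nf) s
  have he : wa ^ (r + i) * wb * wa * (wa ^ (r + i) * wc)
      = wa ^ i * (bBlock (r + i) (i + 1) * (wa ^ r * wc)) := by
    rw [hβ]
    simp only [mul_assoc, pow_mul_pow_mul, mul_pow_mul]
    ring_nf
  refine conj_eq_triple (period (r + i) ^ m * wa ^ i)
    ((bBlock (r + i) (i + 1) * cBlock (r + i) (i + 1)) ^ (t + 1) * bBlock (r + i) (i + 1) *
      (wa ^ r * wc)) ?_ ?_ ?_ ?_ ?_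
  · simp only [FreeMonoid.length_mul, length_pow, length_period, length_wa]
    rw [show 2 * m * (r + i + 2) = m * (2 * (r + i + 2)) by ring]
    omega
  · rw [modeWord_v, mul_assoc, he, add_assoc, pow_add, mul_assoc, ← mul_assoc (_ ^ (t + 1)), hs]
    simp only [mul_assoc]
  · rw [length_v_wa, length_bBlock hik]
  · rw [length_v_wb, length_cBlock hik]
  · rw [hs, show m + t + 1 - m - 1 = t by omega, show r + i + 1 - (i + 1) = r by omega,
      Nat.add_sub_cancel]
    simp only [pow_succ' _ t, mul_assoc]

theorem conj_v_rowC {k n m i : ℕ} (hm : m < n) (hik : i ≤ k + 1) :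
    conj (v k n) ((2 * m + 1) * (k + 2) + i - 1) = rowC k n m i := by
  obtain ⟨t, rfl⟩ : ∃ t, n = m + t + 1 := ⟨n - m - 1, by omega⟩
  obtain ⟨r, hr⟩ : ∃ t, k + 1 = t + i := ⟨k + 1 - i, by omega⟩
  have hri : k + 1 - i = r := by omega
  have hβ : bBlock k i = wa ^ r * wb * wa ^ i := by rw [bBlock, hri]
  have hχ : cBlock k i = wa ^ r * wc * wa ^ i := by rw [cBlock, hri]
  have hs (s : ℕ) := pow_mul_of_semiconj (z := period k) (x := wa ^ k * wb * wa ^ i)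
    (y := cBlock k i * bBlock k i) (by
      rw [hβ, hχ, period]
      simp only [mul_assoc, pow_mul_pow_mul, mul_pow_mul]
      rw [add_comm i r, ← hr]) s
  have he : period k ^ (t + 1) * (wa ^ k * wb * wa * (wa ^ k * wc))
      = wa ^ k * wb * wa ^ i * ((cBlock k i * bBlock k i) ^ (t + 1) * (wa ^ r * wc)) := by
    rw [← mul_assoc (wa ^ k * wb * wa ^ i), ← hs]
    simp only [mul_assoc, pow_mul_pow_mul, mul_pow_mul]
    rw [add_comm i r, ← hr]
  refine conj_eq_triple (period k ^ m * (wa ^ k * wb * wa ^ i))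
    ((cBlock k i * bBlock k i) ^ (t + 1) * (wa ^ r * wc)) ?_ ?_ ?_ ?_ ?_
  · simp only [FreeMonoid.length_mul, length_pow, length_period, length_wa, length_wb]
    rw [show (2 * m + 1) * (k + 2) = m * (2 * (k + 2)) + (k + 2) by ring]
    omega
  · rw [modeWord_v, mul_assoc, add_assoc, pow_add, mul_assoc, he]
    simp only [mul_assoc]
  · rw [length_v_wa, length_cBlock hik]
  · rw [length_v_wb, length_bBlock hik]
  · rw [hs, show m + t + 1 - m - 1 = t by omega, hri]
    simp only [pow_succ' _ t, mul_assoc]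

theorem conj_v_rowB' {k n m i : ℕ} (hm : 1 ≤ m) (hmn : m ≤ n) (hik : i ≤ k) :
    conj (v k n) (2 * m * (k + 2) + i - 1) = rowB' k n m i := by
  obtain ⟨m, rfl⟩ : ∃ t, m = t + 1 := ⟨m - 1, by omega⟩
  obtain ⟨t, rfl⟩ : ∃ t, n = m + t + 1 := ⟨n - m - 1, by omega⟩
  obtain ⟨r, rfl⟩ : ∃ t, k = t + i := ⟨k - i, by omega⟩
  have hri : r + i + 1 - i = r + 1 := by omega
  have hβ : bBlock (r + i) i = wa ^ (r + 1) * wb * wa ^ i := by rw [bBlock, hri]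
  have hχ : cBlock (r + i) i = wa ^ (r + 1) * wc * wa ^ i := by rw [cBlock, hri]
  have hs (s : ℕ) := pow_mul_of_semiconj (z := period (r + i))
    (x := wa ^ (r + i) * wb * wa ^ i * cBlock (r + i) i)
    (y := bBlock (r + i) i * cBlock (r + i) i) (by
      rw [hβ, hχ, period]
      simp only [mul_assoc, pow_mul_pow_mul, mul_pow_mul]
      ring_nf) s
  have he : period (r + i) ^ (t + 1) * (wa ^ (r + i) * wb * wa * (wa ^ (r + i) * wc))
      = wa ^ (r + i) * wb * wa * (wa ^ (r + i) * wc * wa ^ i) *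
        ((bBlock (r + i) i * cBlock (r + i) i) ^ t * bBlock (r + i) i * (wa ^ (r + 1) * wc)) := by
    have hx : wa ^ (r + i) * wb * wa * (wa ^ (r + i) * wc * wa ^ i)
        = wa ^ (r + i) * wb * wa ^ i * cBlock (r + i) i := by
      rw [hχ]
      simp only [mul_assoc, pow_mul_pow_mul, mul_pow_mul]
      ring_nf
    rw [hx, mul_assoc (_ ^ t), ← mul_assoc _ (_ ^ t), ← hs, hχ, hβ, pow_succ, period]
    simp only [mul_assoc, pow_mul_pow_mul, mul_pow_mul]
    ring_nf
  refine conj_eq_triple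
    (period (r + i) ^ m * (wa ^ (r + i) * wb * wa * (wa ^ (r + i) * wc * wa ^ i)))
    ((bBlock (r + i) i * cBlock (r + i) i) ^ t * bBlock (r + i) i * (wa ^ (r + 1) * wc))
    ?_ ?_ ?_ ?_ ?_
  · simp only [FreeMonoid.length_mul, length_pow, length_period, length_wa, length_wb, length_wc]
    rw [show 2 * (m + 1) * (r + i + 2) = m * (2 * (r + i + 2)) + 2 * (r + i + 2) by ring]
    omega
  · rw [modeWord_v, mul_assoc, add_assoc, pow_add, mul_assoc, he]
    simp only [mul_assoc]
  · rw [length_v_wa, length_bBlock (by omega)]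
  · rw [length_v_wb, length_cBlock (by omega)]
  · have hx : wa ^ (r + i) * wb * wa * (wa ^ (r + i) * wc * wa ^ i)
        = wa ^ (r + i) * wb * wa ^ i * cBlock (r + i) i := by
      rw [hχ]
      simp only [mul_assoc, pow_mul_pow_mul, mul_pow_mul]
      ring_nf
    have hy : wa ^ (r + 1) * wc * (wa ^ (r + i) * wb * wa ^ i)
        = cBlock (r + i) i * (wa ^ r * wb * wa ^ i) := by
      rw [hχ]
      simp only [mul_assoc, pow_mul_pow_mul]
      ring_nf
    rw [hx, hs, show m + t + 1 - (m + 1) = t by omega, Nat.add_sub_cancel, Nat.add_sub_cancel]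
    generalize bBlock (r + i) i = β at *
    generalize cBlock (r + i) i = χ at *
    have hcomm : (β * χ) ^ t * (β * χ) = β * χ * (β * χ) ^ t :=
      (pow_succ _ _).symm.trans (pow_succ' _ _)
    calc _ = (β * χ) ^ t * β * (wa ^ (r + 1) * wc * (wa ^ (r + i) * wb * wa ^ i)) * χ *
          (β * χ) ^ m := by simp only [mul_assoc]
      _ = (β * χ) ^ t * (β * χ) * (wa ^ r * wb * wa ^ i) * χ * (β * χ) ^ m := by
        rw [hy]; simp only [mul_assoc]
      _ = _ := by rw [hcomm]; simp only [mul_assoc]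

theorem conj_v_badStar {k n : ℕ} (hn : 0 < n) :
    conj (v k n) (2 * n * (k + 2) + k) = badStar k n := by
  obtain ⟨n, rfl⟩ : ∃ t, n = t + 1 := ⟨n - 1, by omega⟩
  have hs (s : ℕ) := pow_mul_of_semiconj (z := period k) (x := wa ^ k * wb)
    (y := wa ^ (k + 1) * wc * wa ^ (k + 1) * wb) (by
      rw [period]
      simp only [mul_assoc, mul_pow_mul]) s
  refine conj_eq_triple (period k ^ (n + 1) * wa ^ k) (wb * wa * (wa ^ k * wc)) ?_ ?_ ?_ ?_ ?_
  · simp only [FreeMonoid.length_mul, length_pow, length_period, length_wa]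
    ring
  · rw [modeWord_v]
    simp only [mul_assoc]
  · rw [length_v_wa]
    simp [FreeMonoid.length_mul, length_pow, length_wa, length_wb]
    ring
  · rw [length_v_wb]
    simp [FreeMonoid.length_mul, length_pow, length_wa, length_wb, length_wc]
    ring
  · have he : period k * wa ^ k = wa ^ k * wb * (wa ^ (k + 1) * wc * wa ^ (k + 1)) := by
      rw [period]
      simp only [mul_assoc, mul_pow_mul, ← pow_succ']
    rw [Nat.add_sub_cancel, pow_succ, mul_assoc (period k ^ n), he, ← mul_assoc (period k ^ n), hs]
    simp only [mul_assoc, mul_pow_mul]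

theorem conj_v_goodRow {k n l : ℕ} (hn : 0 < n) (hl : l ≤ k) :
    conj (v k n) (2 * n * (k + 2) + k + 1 + l) = goodRow k n l := by
  obtain ⟨n, rfl⟩ : ∃ t, n = t + 1 := ⟨n - 1, by omega⟩
  obtain ⟨r, rfl⟩ : ∃ t, k = t + l := ⟨k - l, by omega⟩
  have hs (s : ℕ) := pow_mul_of_semiconj (z := period (r + l))
    (x := wa ^ (r + l) * wb * wa ^ l * wa)
    (y := wa ^ r * wc * wa ^ l * wa * wa ^ r * wb * wa ^ l * wa) (by
      rw [period]
      simp only [mul_assoc, pow_mul_pow_mul, mul_pow_mul, ← pow_succ]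
      ring_nf) s
  refine conj_eq_triple (period (r + l) ^ (n + 1) * (wa ^ (r + l) * wb * wa ^ l))
    (wa * (wa ^ r * wc)) ?_ ?_ ?_ ?_ ?_
  · simp only [FreeMonoid.length_mul, length_pow, length_period, length_wa, length_wb]
    ring
  · rw [modeWord_v]
    simp only [mul_assoc, pow_mul_pow_mul, mul_pow_mul]
    ring_nf
  · rw [length_v_wa]
    simp [FreeMonoid.length_mul, length_pow, length_wa, length_wc]
    ring
  · rw [length_v_wb]
    simp [FreeMonoid.length_mul, length_pow, length_wa, length_wb]
    ring
  · have he : period (r + l) * (wa ^ (r + l) * wb * wa ^ l)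
        = wa ^ (r + l) * wb * wa ^ l * wa *
          (wa ^ r * wc * wa ^ l * wa * wa ^ r * wb * wa ^ l) := by
      rw [period]
      simp only [mul_assoc, pow_mul_pow_mul, mul_pow_mul, ← pow_succ]
      ring_nf
    rw [Nat.add_sub_cancel, Nat.add_sub_cancel, pow_succ, mul_assoc (period (r + l) ^ n), he,
      ← mul_assoc (period (r + l) ^ n), hs, add_comm r l, pow_add]
    simp only [mul_assoc]

theorem conj_v_badStarStar {k n : ℕ} (hn : 0 < n) :
    conj (v k n) (2 * n * (k + 2) + 2 * k + 2) = badStarStar k n := by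
  obtain ⟨n, rfl⟩ : ∃ t, n = t + 1 := ⟨n - 1, by omega⟩
  have hs (s : ℕ) := pow_mul_of_semiconj (z := period k) (x := wa ^ k * wb * (wa ^ (k + 1) * wc))
    (y := wa ^ (k + 1) * wb * wa ^ (k + 1) * wc) (by
      rw [period]
      simp only [mul_assoc, mul_pow_mul]) s
  refine conj_eq_triple (period k ^ (n + 1) * (wa ^ k * wb * wa * wa ^ k)) wc ?_ ?_ ?_ ?_ ?_
  · simp only [FreeMonoid.length_mul, length_pow, length_period, length_wa, length_wb]
    ring
  · rw [modeWord_v]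
    simp only [mul_assoc]
  · rw [length_v_wa]
    simp [FreeMonoid.length_mul, length_pow, length_wa, length_wb, length_wc]
    ring
  · rw [length_v_wb]
    simp [FreeMonoid.length_mul, length_pow, length_wa, length_wc]
  · have he : period k * (wa ^ k * wb * wa * wa ^ k)
        = wa ^ k * wb * (wa ^ (k + 1) * wc) * (wa ^ (k + 1) * wb * wa ^ (k + 1)) := by
      rw [period]
      simp only [mul_assoc, mul_pow_mul, ← pow_succ']
    rw [Nat.add_sub_cancel, pow_succ, mul_assoc (period k ^ n), he, ← mul_assoc (period k ^ n), hs]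
    simp only [mul_assoc]

/-! ### The conjugates are pairwise distinct -/

theorem modeWord_conj (σ : Subst) (j : ℕ) :
    FreeMonoid.toList (modeWord (conj σ j)) = (FreeMonoid.toList (modeWord σ)).rotate j := by
  simp only [conj]
  generalize (FreeMonoid.toList (modeWord σ)).rotate j = w
  simp only [modeWord, map_mul, triple_wa, triple_wb, triple_wc, FreeMonoid.toList_mul,
    FreeMonoid.toList_ofList]
  rw [← List.drop_drop, List.append_assoc, List.take_append_drop, List.take_append_drop]

theorem conj_mod (σ : Subst) (j : ℕ) : conj σ (j % (modeWord σ).length) = conj σ j := by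
  simp only [conj, FreeMonoid.length, List.rotate_mod]

/-- The sum of the positions of the letter `t` in a list, counted from `0`. -/
def positionSum {α : Type*} [DecidableEq α] (t : α) : List α → ℕ
  | [] => 0
  | _ :: l => positionSum t l + l.count t

theorem positionSum_append_singleton {α : Type*} [DecidableEq α] (t x : α) (l : List α) :
    positionSum t (l ++ [x]) = positionSum t l + if x = t then l.length else 0 := by
  induction l with
  | nil => simp [positionSum]
  | cons y l ih =>
    simp only [List.cons_append, positionSum, ih, List.count_append, List.count_singleton,
      List.length_cons, beq_iff_eq]
    split_ifs <;> omega

/-- Modulo the length, a rotation by one letter lowers each of the positions of `t` by one. -/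
theorem positionSum_rotate {α : Type*} [DecidableEq α] (t : α) (l : List α) (j : ℕ) :
    (positionSum t (l.rotate j) : ZMod l.length) + j * l.count t = positionSum t l := by
  induction j with
  | zero => simp
  | succ j ih =>
    rw [← ih, ← List.rotate_rotate]
    have hc : l.count t = (l.rotate j).count t := ((List.rotate_perm l j).count_eq t).symm
    have hlen : l.length = (l.rotate j).length := (List.length_rotate l j).symm
    generalize l.rotate j = l' at *
    rw [hc, hlen]
    cases l' with
    | nil => simp
    | cons x l' =>
      have h0 : ((l'.length : ℕ) : ZMod (x :: l').length) + 1 = 0 := by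
        exact_mod_cast ZMod.natCast_self (x :: l').length
      rw [List.rotate_cons_succ, List.rotate_zero, positionSum_append_singleton, positionSum,
        List.count_cons]
      by_cases hx : x = t
      · simp only [hx, beq_self_eq_true, if_true, Nat.cast_add, Nat.cast_one]
        subst hx
        linear_combination h0
      · simp only [hx, beq_iff_eq, if_false, Nat.cast_add, Nat.cast_one, Nat.cast_zero]
        ring

theorem rotate_injOn_of_coprime_count {α : Type*} [DecidableEq α] (t : α) (l : List α)
    (h : Nat.Coprime (l.count t) l.length) : Set.InjOn l.rotate (Set.Iio l.length) := by
  intro i hi j hj hij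
  have e := (positionSum_rotate t l i).trans (positionSum_rotate t l j).symm
  rw [show l.rotate i = l.rotate j from hij] at e
  have hu := (ZMod.unitOfCoprime _ h).isUnit
  rw [ZMod.coe_unitOfCoprime] at hu
  have := (ZMod.natCast_eq_natCast_iff' i j l.length).1 (hu.mul_right_cancel (add_left_cancel e))
  rwa [Nat.mod_eq_of_lt hi, Nat.mod_eq_of_lt hj] at this

theorem count_pow {t : Letter} (w : Word) (n : ℕ) :
    (FreeMonoid.toList (w ^ n)).count t = n * (FreeMonoid.toList w).count t := by
  induction n with
  | zero => simp
  | succ n ih => rw [pow_succ, FreeMonoid.toList_mul, List.count_append, ih]; ring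

theorem conj_v_injOn {k n : ℕ} (hn : 0 < n) : Set.InjOn (conj (v k n)) (Set.Iio (size k n)) := by
  have hlen := length_modeWord_v k n hn
  rw [← hlen]
  have hc : (FreeMonoid.toList (modeWord (v k n))).count Letter.c = n + 1 := by
    obtain ⟨n, rfl⟩ : ∃ t, n = t + 1 := ⟨n - 1, by omega⟩
    simp [modeWord_v, period, FreeMonoid.toList_mul, count_pow, wa, wb, wc]
  intro i hi j hj hij
  refine rotate_injOn_of_coprime_count Letter.c (FreeMonoid.toList (modeWord (v k n))) ?_ hi hj ?_
  · -- The length is `-1` modulo `n + 1`, the number of letters `c`.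
    rw [hc, show (FreeMonoid.toList (modeWord (v k n))).length = size k n from hlen]
    have h1 : size k n + 1 = (n + 1) * (2 * (k + 2)) := by
      rw [size_eq]; ring
    have h2 : Nat.Coprime (size k n + 1) (size k n) := by simp
    rw [h1] at h2
    exact Nat.Coprime.coprime_mul_right h2
  · rw [← modeWord_conj, ← modeWord_conj, hij]

/-! ### The projections of the table -/

@[simp] theorem projBC_wa : projBC wa = wlo := rfl

@[simp] theorem projBC_wb : projBC wb = whi := rfl

@[simp] theorem projBC_wc : projBC wc = whi := rfl

@[simp] theorem projAB_wa : projAB wa = wlo := rfl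

@[simp] theorem projAB_wb : projAB wb = wlo := rfl

@[simp] theorem projAB_wc : projAB wc = whi := rfl

@[simp] theorem projCA_wa : projCA wa = wlo := rfl

@[simp] theorem projCA_wb : projCA wb = whi := rfl

@[simp] theorem projCA_wc : projCA wc = wlo := rfl

theorem apotomic_triple (x y z : Word) :
    apotomic (triple x y z) = pair (projBC x) (projBC y * projBC z) := by
  simp [apotomic]

theorem apoSyntonic_triple (x y z : Word) :
    apoSyntonic (triple x y z) = pair (projAB x * projAB y) (projAB z) := by
  simp [apoSyntonic]

theorem syntonic_triple (x y z : Word) :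
    syntonic (triple x y z) = pair (projCA x * projCA y) (projCA z) := by
  simp [syntonic]

theorem apotomic_rowB (r i m t : ℕ) :
    apotomic (rowB (r + i) (m + t + 1) m (i + 1)) = pair (wlo ^ r * whi * wlo ^ (i + 1))
      ((wlo ^ r * whi * wlo ^ (i + 1)) ^ (2 * (t + 1)) * (wlo ^ r * whi * wlo ^ i) *
        (wlo ^ r * whi * wlo ^ (i + 1)) ^ (2 * m)) := by
  rw [rowB, apotomic_triple]
  simp only [bBlock, cBlock, show r + i + 1 - (i + 1) = r by omega, Nat.add_sub_cancel,
    show m + t + 1 - m - 1 = t by omega, map_mul, map_pow, projBC_wa, projBC_wb, projBC_wc]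
  generalize wlo ^ r * whi * wlo ^ (i + 1) = X
  simp only [← pow_two, ← pow_mul, ← mul_assoc, ← pow_succ, ← pow_succ']
  ring_nf

theorem apoSyntonic_rowB (r i m t : ℕ) :
    apoSyntonic (rowB (r + i) (m + t + 1) m (i + 1))
      = pair (wlo ^ (r + i + 2 + r) * whi * wlo ^ (i + 1))
        ((wlo ^ (r + i + 2 + r) * whi * wlo ^ (i + 1)) ^ t *
          (wlo ^ (r + i + 2 + r) * whi * wlo ^ i) *
          (wlo ^ (r + i + 2 + r) * whi * wlo ^ (i + 1)) ^ m) := by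
  have h : wlo ^ r * wlo * wlo ^ (i + 1) * (wlo ^ r * whi * wlo ^ (i + 1))
      = wlo ^ (r + i + 2 + r) * whi * wlo ^ (i + 1) := by
    simp only [mul_assoc, pow_mul_pow_mul, mul_pow_mul]
    ring_nf
  have h' : wlo ^ r * wlo * wlo ^ (i + 1) * (wlo ^ r * whi * wlo ^ i)
      = wlo ^ (r + i + 2 + r) * whi * wlo ^ i := by
    simp only [mul_assoc, pow_mul_pow_mul, mul_pow_mul]
    ring_nf
  rw [rowB, apoSyntonic_triple]
  simp only [bBlock, cBlock, show r + i + 1 - (i + 1) = r by omega, Nat.add_sub_cancel,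
    show m + t + 1 - m - 1 = t by omega, map_mul, map_pow, projAB_wa, projAB_wb, projAB_wc, h]
  rw [mul_assoc (_ ^ t), h']

theorem syntonic_rowB (r i m t : ℕ) :
    syntonic (rowB (r + i) (m + t + 1) m (i + 1))
      = pair (wlo ^ r * whi * wlo ^ (i + (r + i + 2) + 1))
        ((wlo ^ r * whi * wlo ^ (i + (r + i + 2) + 1)) ^ t *
          (wlo ^ r * whi * wlo ^ (i + (r + i + 2))) *
          (wlo ^ r * whi * wlo ^ (i + (r + i + 2) + 1)) ^ m) := by
  have h : wlo ^ r * whi * wlo ^ (i + 1) * (wlo ^ r * wlo * wlo ^ (i + 1))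
      = wlo ^ r * whi * wlo ^ (i + (r + i + 2) + 1) := by
    simp only [mul_assoc, ← pow_add, ← pow_succ]
    ring_nf
  have h' : wlo ^ r * whi * wlo ^ (i + 1) * (wlo ^ r * wlo * wlo ^ i)
      = wlo ^ r * whi * wlo ^ (i + (r + i + 2)) := by
    simp only [mul_assoc, ← pow_add, ← pow_succ]
    ring_nf
  rw [rowB, syntonic_triple]
  simp only [bBlock, cBlock, show r + i + 1 - (i + 1) = r by omega, Nat.add_sub_cancel,
    show m + t + 1 - m - 1 = t by omega, map_mul, map_pow, projCA_wa, projCA_wb, projCA_wc, h]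
  rw [mul_assoc (_ ^ t), h']

theorem isPWWF_rowB {k n m i : ℕ} (hm : m < n) (hi : 1 ≤ i) (hik : i ≤ k + 1) :
    IsPWWF (rowB k n m i) := by
  obtain ⟨t, rfl⟩ : ∃ t, n = m + t + 1 := ⟨n - m - 1, by omega⟩
  obtain ⟨i, rfl⟩ : ∃ t, i = t + 1 := ⟨i - 1, by omega⟩
  obtain ⟨r, rfl⟩ : ∃ t, k = t + i := ⟨k - i, by omega⟩
  refine ⟨?_, ?_, ?_⟩
  · exact apotomic_rowB r i m t ▸ isSpecialSturmian_pair_right _ _ _ _ rfl rfl rfl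
  · exact apoSyntonic_rowB r i m t ▸ isSpecialSturmian_pair_right _ _ _ _ rfl rfl rfl
  · exact syntonic_rowB r i m t ▸ isSpecialSturmian_pair_right _ _ _ _ rfl rfl rfl

theorem isPWWF_rowC {k n m i : ℕ} (hm : m < n) (hik : i ≤ k + 1) :
    IsPWWF (rowC k n m i) := by
  obtain ⟨t, rfl⟩ : ∃ t, n = m + t + 1 := ⟨n - m - 1, by omega⟩
  obtain ⟨r, hr⟩ : ∃ t, k + 1 = t + i := ⟨k + 1 - i, by omega⟩
  refine ⟨?_, ?_, ?_⟩
  · rw [rowC, apotomic_triple]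
    simp only [bBlock, cBlock, show k + 1 - i = r by omega,
      show m + t + 1 - m - 1 = t by omega, map_mul, map_pow, projBC_wa, projBC_wb, projBC_wc]
    rcases i with _ | i
    · -- The long block is a full block followed by one that lacks its first letter.
      obtain rfl : r = k + 1 := by omega
      refine isSpecialSturmian_pair_left k 0 (2 * t + 2) (2 * m) rfl rfl ?_
      simp only [pow_zero, mul_one]
      rw [mul_assoc _ (wlo ^ k) whi]
      generalize wlo ^ (k + 1) * whi = X
      simp only [← pow_two, ← pow_mul, ← mul_assoc, ← pow_succ, ← pow_succ']
    · -- The long block is one that lacks its last letter, followed by a full block.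
      obtain rfl : k = r + i := by omega
      refine isSpecialSturmian_pair_right r i (2 * t + 1) (2 * m + 1) rfl rfl ?_
      have h : wlo ^ r * whi * wlo ^ (r + i) * whi * wlo ^ (i + 1)
          = wlo ^ r * whi * wlo ^ i * (wlo ^ r * whi * wlo ^ (i + 1)) := by
        simp only [mul_assoc, pow_mul_pow_mul, add_comm]
      rw [h]
      generalize wlo ^ r * whi * wlo ^ (i + 1) = X
      simp only [← pow_two, ← pow_mul, pow_succ' X (2 * m), pow_succ' X (2 * t), mul_assoc]
  · rw [rowC, apoSyntonic_triple]
    simp only [bBlock, cBlock, show k + 1 - i = r by omega,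
      show m + t + 1 - m - 1 = t by omega, map_mul, map_pow, projAB_wa, projAB_wb, projAB_wc]
    refine isSpecialSturmian_pair_right r (k + 1 + i) t m ?_ rfl ?_
    · simp only [mul_assoc, ← pow_add, ← pow_succ]
      rw [show i + (r + 1 + i) = k + 1 + i + 1 by omega]
    · rw [mul_assoc _ (wlo ^ k) wlo, ← pow_succ wlo k, mul_assoc _ (wlo ^ (k + 1)), ← pow_add]
  · rw [rowC, syntonic_triple]
    simp only [bBlock, cBlock, show k + 1 - i = r by omega,
      show m + t + 1 - m - 1 = t by omega, map_mul, map_pow, projCA_wa, projCA_wb, projCA_wc]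
    refine isSpecialSturmian_pair_left (r + k + 1) i t m ?_ rfl ?_
    · simp only [mul_assoc, mul_pow_mul, pow_mul_pow_mul]
      rw [show r + (i + r + 1) = r + k + 1 + 1 by omega]
    · simp only [mul_assoc, mul_pow_mul, pow_mul_pow_mul, ← add_assoc]

theorem isPWWF_rowB' {k n m i : ℕ} (hm : 1 ≤ m) (hmn : m ≤ n) (hik : i ≤ k) :
    IsPWWF (rowB' k n m i) := by
  obtain ⟨m, rfl⟩ : ∃ t, m = t + 1 := ⟨m - 1, by omega⟩
  obtain ⟨t, rfl⟩ : ∃ t, n = m + 1 + t := ⟨n - m - 1, by omega⟩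
  obtain ⟨r, rfl⟩ : ∃ t, k = t + i := ⟨k - i, by omega⟩
  refine ⟨?_, ?_, ?_⟩
  · rw [rowB', apotomic_triple]
    simp only [bBlock, cBlock, show r + i + 1 - i = r + 1 by omega, Nat.add_sub_cancel,
      Nat.add_sub_cancel_left, map_mul, map_pow, projBC_wa, projBC_wb, projBC_wc]
    refine isSpecialSturmian_pair_left r i (2 * t + 1) (2 * m + 1) rfl rfl ?_
    generalize wlo ^ (r + 1) * whi * wlo ^ i = X
    simp only [← pow_two, ← pow_mul, pow_succ' X (2 * m), pow_succ' X (2 * t), mul_assoc]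
  · rw [rowB', apoSyntonic_triple]
    simp only [bBlock, cBlock, show r + i + 1 - i = r + 1 by omega, Nat.add_sub_cancel,
      Nat.add_sub_cancel_left, map_mul, map_pow, projAB_wa, projAB_wb, projAB_wc]
    refine isSpecialSturmian_pair_left (r + i + 1 + r + 1) i t m ?_ rfl ?_
    · simp only [mul_assoc, mul_pow_mul, pow_mul_pow_mul]
      ring_nf
    · simp only [mul_assoc, mul_pow_mul, pow_mul_pow_mul]
      ring_nf
  · rw [rowB', syntonic_triple]
    simp only [bBlock, cBlock, show r + i + 1 - i = r + 1 by omega, Nat.add_sub_cancel,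
      Nat.add_sub_cancel_left, map_mul, map_pow, projCA_wa, projCA_wb, projCA_wc]
    refine isSpecialSturmian_pair_left r (r + i + 2 + i) t m ?_ rfl ?_
    · simp only [mul_assoc, ← pow_add, ← pow_succ]
      ring_nf
    · simp only [mul_assoc, mul_pow_mul, pow_mul_pow_mul]
      ring_nf

theorem isPWWF_goodRow {k n l : ℕ} (hn : 0 < n) (hl : l ≤ k) : IsPWWF (goodRow k n l) := by
  obtain ⟨n, rfl⟩ : ∃ t, n = t + 1 := ⟨n - 1, by omega⟩
  obtain ⟨r, rfl⟩ : ∃ t, k = t + l := ⟨k - l, by omega⟩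
  refine ⟨?_, ?_, ?_⟩
  · rw [goodRow, apotomic_triple]
    simp only [Nat.add_sub_cancel, map_mul, map_pow, projBC_wa, projBC_wb, projBC_wc]
    refine isSpecialSturmian_pair_shift r l (2 * n + 2) rfl (by simp only [mul_assoc]) ?_
    have h (z : FreeMonoid Two) :
        z * wlo ^ r * whi * wlo ^ l = z * (wlo ^ r * whi * wlo ^ l) := by simp only [mul_assoc]
    simp only [h]
    generalize wlo ^ r * whi * wlo ^ l = Y
    rw [mul_assoc _ Y wlo, ← pow_two, ← pow_mul, pow_succ', pow_succ]
    simp only [mul_assoc]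
  · rw [goodRow, apoSyntonic_triple]
    simp only [Nat.add_sub_cancel, map_mul, map_pow, projAB_wa, projAB_wb, projAB_wc]
    have h : wlo ^ r * whi * wlo ^ l * wlo * wlo ^ r * wlo * wlo ^ l
        = wlo ^ r * whi * wlo ^ (r + l + l + 2) := by
      simp only [mul_assoc, ← pow_add, ← pow_succ]
      ring_nf
    rw [h]
    refine isSpecialSturmian_pair_shift r (r + l + l + 2) n rfl ?_ rfl
    simp only [mul_assoc, mul_pow_mul, ← pow_add, ← pow_succ]
    ring_nf
  · rw [goodRow, syntonic_triple]
    simp only [Nat.add_sub_cancel, map_mul, map_pow, projCA_wa, projCA_wb, projCA_wc]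
    have h : wlo * wlo ^ r * wlo * wlo ^ l * (wlo ^ r * whi * wlo ^ l * wlo)
        = wlo ^ (r + l + r + 2) * whi * wlo ^ (l + 1) := by
      simp only [mul_assoc, mul_pow_mul, pow_mul_pow_mul, ← pow_succ]
      ring_nf
    have h' : wlo ^ r * wlo * wlo ^ l * wlo * wlo ^ r * whi * wlo ^ l
        = wlo ^ (r + l + r + 2) * whi * wlo ^ l := by
      simp only [mul_assoc, mul_pow_mul, pow_mul_pow_mul]
      ring_nf
    refine isSpecialSturmian_pair_right (r + l + r + 2) l n 0 h rfl ?_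
    rw [h, h', pow_zero, mul_one, pow_succ wlo l]
    simp only [mul_assoc]

/-- The syntonic projection of `bad*` maps `lo` to a word that starts with `hi` and `hi` to a word
that starts with `lo`. -/
theorem isBadStar_badStar {k n : ℕ} (hn : 0 < n) : IsBadStar (badStar k n) := by
  obtain ⟨n, rfl⟩ : ∃ t, n = t + 1 := ⟨n - 1, by omega⟩
  refine ⟨?_, ?_, ?_⟩
  · rw [badStar, apotomic_triple]
    simp only [Nat.add_sub_cancel, map_mul, map_pow, projBC_wa, projBC_wb, projBC_wc]
    refine isSpecialSturmian_pair_right 0 k 0 (2 * n + 2) (by rw [pow_zero, one_mul])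
      (by rw [pow_zero, one_mul]) ?_
    generalize wlo ^ (k + 1) = x
    have h : whi * (x * whi) ^ (2 * n) = (whi * x) ^ (2 * n) * whi :=
      (mul_pow_mul_comm _ _ _).symm
    rw [mul_assoc (x * whi) x whi, ← pow_two, ← pow_mul, mul_assoc _ whi,
      ← mul_assoc whi (_ ^ _), h, pow_succ _ (2 * n + 1), pow_succ _ (2 * n)]
    simp only [mul_assoc, pow_zero, one_mul]
  · rw [badStar, apoSyntonic_triple]
    simp only [Nat.add_sub_cancel, map_mul, map_pow, projAB_wa, projAB_wb, projAB_wc]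
    refine isSpecialSturmian_pair_shift (k + 1) (k + 1) n rfl ?_ rfl
    simp only [mul_assoc, ← pow_succ]
  · rw [badStar, syntonic_triple]
    simp only [Nat.add_sub_cancel, map_mul, map_pow, projCA_wa, projCA_wb, projCA_wc]
    rcases n with _ | n
    · rw [pow_zero, one_mul, pow_succ' wlo k]
      simp only [mul_assoc]
      exact not_isSpecialSturmian_pair _ _
    · rw [pow_succ' _ n, pow_succ' wlo k]
      simp only [mul_assoc]
      exact not_isSpecialSturmian_pair _ _

/-- The apotomic and the apo-syntonic projection of `bad**` map `lo` to a word that starts with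
`hi` and `hi` to a word that starts with `lo`. -/
theorem isBadStarStar_badStarStar {k n : ℕ} (hn : 0 < n) : IsBadStarStar (badStarStar k n) := by
  obtain ⟨n, rfl⟩ : ∃ t, n = t + 1 := ⟨n - 1, by omega⟩
  refine ⟨?_, ?_, ?_⟩
  · rw [badStarStar, apotomic_triple]
    simp only [Nat.add_sub_cancel, map_mul, map_pow, projBC_wa, projBC_wb, projBC_wc]
    rw [pow_succ', mul_assoc whi, mul_assoc wlo, mul_assoc wlo]
    exact not_isSpecialSturmian_pair _ _
  · rw [badStarStar, apoSyntonic_triple]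
    simp only [Nat.add_sub_cancel, map_mul, map_pow, projAB_wa, projAB_wb, projAB_wc]
    rcases n with _ | n
    · rw [pow_zero, one_mul, pow_succ' wlo k]
      simp only [mul_assoc]
      exact not_isSpecialSturmian_pair _ _
    · rw [pow_succ' _ n, pow_succ' wlo k]
      simp only [mul_assoc]
      exact not_isSpecialSturmian_pair _ _
  · rw [badStarStar, syntonic_triple]
    simp only [Nat.add_sub_cancel, map_mul, map_pow, projCA_wa, projCA_wb, projCA_wc]
    have h : wlo * wlo ^ k * whi * (wlo ^ (k + 1) * wlo)
        = wlo ^ (k + 1) * whi * wlo ^ (k + 1 + 1) := by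
      rw [← pow_succ', ← pow_succ]
    refine isSpecialSturmian_pair_right (k + 1) (k + 1) n 0 h rfl ?_
    rw [h, pow_zero, mul_one, pow_succ wlo (k + 1)]
    simp only [mul_assoc]

theorem v_eq_rowB {k n : ℕ} (hn : 0 < n) : v k n = rowB k n 0 1 := by
  obtain ⟨n, rfl⟩ : ∃ t, n = t + 1 := ⟨n - 1, by omega⟩
  simp [v, rowB, bBlock, cBlock]

theorem goodRow_zero (k n : ℕ) : goodRow k n 0 = γ k n := by
  simp only [goodRow, γ, Nat.sub_zero, pow_zero, mul_one, ← pow_succ', mul_assoc]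

theorem isSpecialStandard_apotomic_v {k n : ℕ} (hn : 0 < n) :
    IsSpecialStandard (apotomic (v k n)) := by
  rw [v_eq_rowB hn]
  obtain ⟨n, rfl⟩ : ∃ t, n = 0 + t + 1 := ⟨n - 1, by omega⟩
  exact apotomic_rowB k 0 0 n ▸ isSpecialStandard_pair k (2 * (n + 1)) (by simp) rfl (by simp)

theorem isSpecialStandard_apoSyntonic_v {k n : ℕ} (hn : 0 < n) :
    IsSpecialStandard (apoSyntonic (v k n)) := by
  rw [v_eq_rowB hn]
  obtain ⟨n, rfl⟩ : ∃ t, n = 0 + t + 1 := ⟨n - 1, by omega⟩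
  exact apoSyntonic_rowB k 0 0 n ▸
    isSpecialStandard_pair (k + 0 + 2 + k) n (by simp) rfl (by simp)

theorem isSpecialStandard_syntonic_γ {k n : ℕ} (hn : 0 < n) :
    IsSpecialStandard (syntonic (γ k n)) := by
  obtain ⟨n, rfl⟩ : ∃ t, n = t + 1 := ⟨n - 1, by omega⟩
  rw [γ, syntonic_triple]
  simp only [Nat.add_sub_cancel, map_mul, map_pow, projCA_wa, projCA_wb, projCA_wc]
  refine isSpecialStandard_pair (k + 1 + k + 1) n ?_ rfl ?_
  · simp only [mul_assoc, mul_pow_mul, pow_mul_pow_mul]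
    ring_nf
  · simp only [mul_assoc, mul_pow_mul, pow_mul_pow_mul]
    ring_nf

/-! ### Products of exchanges and productions -/

/-- The monoid generated by the `E_{xy}`, the `A_{xy}` and the `P_{xy}`. -/
def elementary : Submonoid Subst := Submonoid.closure (transpositions ∪ productions)

theorem A_eq_triple_ba : A .b .a = triple wa (wb * wa) wc := subst_ext rfl rfl rfl

theorem A_eq_triple_ca : A .c .a = triple wa wb (wc * wa) := subst_ext rfl rfl rfl

theorem A_eq_triple_ab : A .a .b = triple (wa * wb) wb wc := subst_ext rfl rfl rfl

theorem A_eq_triple_cb : A .c .b = triple wa wb (wc * wb) := subst_ext rfl rfl rfl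

theorem P_eq_triple_ba : P .b .a = triple wa (wa * wb) wc := subst_ext rfl rfl rfl

theorem P_eq_triple_ca : P .c .a = triple wa wb (wa * wc) := subst_ext rfl rfl rfl

theorem P_eq_triple_cb : P .c .b = triple wa wb (wb * wc) := subst_ext rfl rfl rfl

theorem P_eq_triple_ac : P .a .c = triple (wc * wa) wb wc := subst_ext rfl rfl rfl

theorem E_eq_triple_ab : E .a .b = triple wb wa wc := subst_ext rfl rfl rfl

theorem E_eq_triple_ac : E .a .c = triple wc wb wa := subst_ext rfl rfl rfl

theorem E_eq_triple_bc : E .b .c = triple wa wc wb := subst_ext rfl rfl rfl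

theorem E_of (x y t : Letter) : E x y (FreeMonoid.of t) = FreeMonoid.of (Equiv.swap x y t) := rfl

theorem A_of (x y t : Letter) : A x y (FreeMonoid.of t)
    = if t = x then FreeMonoid.of x * FreeMonoid.of y else FreeMonoid.of t := rfl

theorem P_of (x y t : Letter) : P x y (FreeMonoid.of t)
    = if t = x then FreeMonoid.of y * FreeMonoid.of x else FreeMonoid.of t := rfl

theorem A_mem_productions {x y : Letter} (h : x ≠ y) : A x y ∈ productions :=
  ⟨x, y, h, Or.inl rfl⟩

theorem P_mem_productions {x y : Letter} (h : x ≠ y) : P x y ∈ productions :=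
  ⟨x, y, h, Or.inr rfl⟩

theorem A_mem_elementary {x y : Letter} (h : x ≠ y) : A x y ∈ elementary :=
  Submonoid.subset_closure (Or.inr (A_mem_productions h))

theorem P_mem_elementary {x y : Letter} (h : x ≠ y) : P x y ∈ elementary :=
  Submonoid.subset_closure (Or.inr (P_mem_productions h))

theorem E_mem_elementary {x y : Letter} (h : x ≠ y) : E x y ∈ elementary :=
  Submonoid.subset_closure (Or.inl ⟨x, y, h, rfl⟩)

theorem A_ca_pow (r : ℕ) : A .c .a ^ r = triple wa wb (wc * wa ^ r) := by
  induction r with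
  | zero => exact subst_ext rfl rfl rfl
  | succ r ih =>
    rw [pow_succ, ih, A_eq_triple_ca, mul_triple]
    simp [pow_succ, mul_assoc]

theorem A_ba_pow (s : ℕ) : A .b .a ^ s = triple wa (wb * wa ^ s) wc := by
  induction s with
  | zero => exact subst_ext rfl rfl rfl
  | succ s ih =>
    rw [pow_succ, ih, A_eq_triple_ba, mul_triple]
    simp [pow_succ, mul_assoc]

theorem P_ca_pow (p : ℕ) : P .c .a ^ p = triple wa wb (wa ^ p * wc) := by
  induction p with
  | zero => exact subst_ext rfl rfl rfl
  | succ p ih =>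
    rw [pow_succ, ih, P_eq_triple_ca, mul_triple]
    simp [pow_succ', mul_assoc]

theorem P_ba_pow (q : ℕ) : P .b .a ^ q = triple wa (wa ^ q * wb) wc := by
  induction q with
  | zero => exact subst_ext rfl rfl rfl
  | succ q ih =>
    rw [pow_succ, ih, P_eq_triple_ba, mul_triple]
    simp [pow_succ', mul_assoc]

theorem padding_eq_triple (p q r s : ℕ) :
    padding p q r s = triple wa (wa ^ q * wb * wa ^ s) (wa ^ p * wc * wa ^ r) := by
  rw [padding, A_ca_pow, A_ba_pow, P_ca_pow, P_ba_pow, mul_triple, mul_triple, mul_triple]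
  simp

theorem padding_mem_closure_productions (p q r s : ℕ) :
    padding p q r s ∈ Submonoid.closure productions := by
  have hA {x y : Letter} (h : x ≠ y) : A x y ∈ Submonoid.closure productions :=
    Submonoid.subset_closure (A_mem_productions h)
  have hP {x y : Letter} (h : x ≠ y) : P x y ∈ Submonoid.closure productions :=
    Submonoid.subset_closure (P_mem_productions h)
  exact mul_mem (mul_mem (mul_mem (pow_mem (hP (by decide)) p) (pow_mem (hP (by decide)) q))
    (pow_mem (hA (by decide)) r)) (pow_mem (hA (by decide)) s)

theorem padding_mem_elementary (p q r s : ℕ) : padding p q r s ∈ elementary :=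
  Submonoid.closure_mono Set.subset_union_right (padding_mem_closure_productions p q r s)

theorem triple_apply_of_mem_closure {u w : Word} (hu : u ∈ Submonoid.closure {wa, wb}) :
    triple wa wb w u = u := by
  induction hu using Submonoid.closure_induction with
  | mem x hx => rcases hx with rfl | rfl <;> rfl
  | one => exact map_one _
  | mul x y _ _ ihx ihy => rw [map_mul, ihx, ihy]

/-- The substitutions that fix `a` and `b` and surround `c` by words over `{a, b}` are
elementary. -/
theorem triple_mem_elementary {u w : Word} (hu : u ∈ Submonoid.closure {wa, wb})
    (hw : w ∈ Submonoid.closure {wa, wb}) : triple wa wb (u * wc * w) ∈ elementary := by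
  have h₁ : triple wa wb (u * wc) ∈ elementary := by
    clear hw
    induction hu using Submonoid.closure_induction with
    | mem x hx =>
      rcases hx with rfl | rfl
      · exact P_eq_triple_ca ▸ P_mem_elementary (by decide)
      · exact P_eq_triple_cb ▸ P_mem_elementary (by decide)
    | one => exact (subst_ext rfl rfl rfl : 1 = triple wa wb (1 * wc)) ▸ one_mem _
    | mul x y hx hy ihx ihy =>
      have h := mul_mem ihy ihx
      rwa [mul_triple, map_mul, triple_apply_of_mem_closure hx, triple_wa, triple_wb, triple_wc,
        ← mul_assoc] at h
  have h₂ : triple wa wb (wc * w) ∈ elementary := by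
    clear hu h₁
    induction hw using Submonoid.closure_induction with
    | mem x hx =>
      rcases hx with rfl | rfl
      · exact A_eq_triple_ca ▸ A_mem_elementary (by decide)
      · exact A_eq_triple_cb ▸ A_mem_elementary (by decide)
    | one => exact (subst_ext rfl rfl rfl : 1 = triple wa wb (wc * 1)) ▸ one_mem _
    | mul x y hx hy ihx ihy =>
      have h := mul_mem ihx ihy
      rwa [mul_triple, map_mul, triple_apply_of_mem_closure hy, triple_wa, triple_wb, triple_wc,
        mul_assoc] at h
  have h := mul_mem h₁ h₂
  rwa [mul_triple, map_mul, triple_apply_of_mem_closure hw, triple_wa, triple_wb, triple_wc] at h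

theorem wa_mem_closure : wa ∈ Submonoid.closure {wa, wb} := Submonoid.subset_closure (by simp)

theorem wb_mem_closure : wb ∈ Submonoid.closure {wa, wb} := Submonoid.subset_closure (by simp)

/-- After the padding, the mode `b a | c a || (b a c a)^t b a c (b a c a)^m` remains; undoing
`A_{ba}` and `P_{ac}` leaves the letters `b` and `a` and a word with one `c`. -/
theorem rowB_mem_elementary {k n m i : ℕ} (hm : m < n) (hi : 1 ≤ i) (hik : i ≤ k + 1) :
    rowB k n m i ∈ elementary := by
  obtain ⟨t, rfl⟩ : ∃ t, n = m + t + 1 := ⟨n - m - 1, by omega⟩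
  obtain ⟨i, rfl⟩ : ∃ t, i = t + 1 := ⟨i - 1, by omega⟩
  obtain ⟨r, rfl⟩ : ∃ t, k = t + i := ⟨k - i, by omega⟩
  have h : rowB (r + i) (m + t + 1) m (i + 1) = padding r r i i * (A .b .a * (P .a .c *
      (triple wa wb ((wb * wa) ^ t * wb * wc * (wb * wa) ^ m) * E .a .b))) := by
    rw [rowB, bBlock, cBlock, E_eq_triple_ab, P_eq_triple_ac, A_eq_triple_ba, padding_eq_triple,
      mul_triple, mul_triple, mul_triple, mul_triple, show r + i + 1 - (i + 1) = r by omega,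
      Nat.add_sub_cancel, show m + t + 1 - m - 1 = t by omega]
    simp only [map_mul, map_pow, triple_wa, triple_wb, triple_wc, pow_succ, mul_assoc]
  rw [h]
  exact mul_mem (padding_mem_elementary _ _ _ _) (mul_mem (A_mem_elementary (by decide))
    (mul_mem (P_mem_elementary (by decide)) (mul_mem (triple_mem_elementary
      (mul_mem (pow_mem (mul_mem wb_mem_closure wa_mem_closure) _) wb_mem_closure)
      (pow_mem (mul_mem wb_mem_closure wa_mem_closure) _)) (E_mem_elementary (by decide)))))

/-- For `i = 0` no `a` follows the letters `b` and `c` in their blocks, and the remainder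
`a c | a b || ...` is reduced by `P_{ca}` and `A_{ab}` instead of `A_{ba}` and `P_{ac}`. -/
theorem rowC_mem_elementary {k n m i : ℕ} (hm : m < n) (hik : i ≤ k + 1) :
    rowC k n m i ∈ elementary := by
  obtain ⟨t, rfl⟩ : ∃ t, n = m + t + 1 := ⟨n - m - 1, by omega⟩
  rcases i with _ | i
  · have h : rowC k (m + t + 1) m 0 = padding k k 0 0 * (P .c .a * (A .a .b * (E .a .b *
        (E .a .c * triple wa wb ((wa * wb) ^ t * wa * wc * (wa * wb) ^ m))))) := by
      rw [rowC, bBlock, cBlock, E_eq_triple_ab, E_eq_triple_ac, P_eq_triple_ca, A_eq_triple_ab,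
        padding_eq_triple, mul_triple, mul_triple, mul_triple, mul_triple, mul_triple,
        show m + t + 1 - m - 1 = t by omega]
      simp only [map_mul, map_pow, triple_wa, triple_wb, triple_wc, pow_succ', mul_assoc, pow_zero,
        mul_one, Nat.sub_zero]
    rw [h]
    exact mul_mem (padding_mem_elementary _ _ _ _) (mul_mem (P_mem_elementary (by decide))
      (mul_mem (A_mem_elementary (by decide)) (mul_mem (E_mem_elementary (by decide))
        (mul_mem (E_mem_elementary (by decide)) (triple_mem_elementary
          (mul_mem (pow_mem (mul_mem wa_mem_closure wb_mem_closure) _) wa_mem_closure)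
          (pow_mem (mul_mem wa_mem_closure wb_mem_closure) _))))))
  · obtain ⟨r, rfl⟩ : ∃ t, k = i + t := ⟨k - i, by omega⟩
    have h : rowC (i + r) (m + t + 1) m (i + 1) = padding r r i i * (A .b .a * (P .a .c *
        triple wa wb ((wa * wb) ^ t * wc * (wb * (wa * wb) ^ m)))) := by
      rw [rowC, bBlock, cBlock, P_eq_triple_ac, A_eq_triple_ba, padding_eq_triple,
        mul_triple, mul_triple, mul_triple, show i + r + 1 - (i + 1) = r by omega,
        show m + t + 1 - m - 1 = t by omega, pow_add wa i r]
      simp only [map_mul, map_pow, triple_wa, triple_wb, triple_wc, pow_succ, mul_assoc]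
    rw [h]
    exact mul_mem (padding_mem_elementary _ _ _ _) (mul_mem (A_mem_elementary (by decide))
      (mul_mem (P_mem_elementary (by decide)) (triple_mem_elementary
        (pow_mem (mul_mem wa_mem_closure wb_mem_closure) _)
        (mul_mem wb_mem_closure (pow_mem (mul_mem wa_mem_closure wb_mem_closure) _)))))

theorem rowB'_mem_elementary {k n m i : ℕ} (hm : 1 ≤ m) (hmn : m ≤ n) (hik : i ≤ k) :
    rowB' k n m i ∈ elementary := by
  obtain ⟨m, rfl⟩ : ∃ t, m = t + 1 := ⟨m - 1, by omega⟩
  obtain ⟨t, rfl⟩ : ∃ t, n = m + 1 + t := ⟨n - m - 1, by omega⟩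
  obtain ⟨r, rfl⟩ : ∃ t, k = t + i := ⟨k - i, by omega⟩
  have h : rowB' (r + i) (m + 1 + t) (m + 1) i = padding r r i i * (P .c .a * (A .a .b *
      (E .b .c * triple wa wb ((wa * wb) ^ t * wc * (wb * (wa * wb) ^ m))))) := by
    rw [rowB', bBlock, cBlock, E_eq_triple_bc, P_eq_triple_ca, A_eq_triple_ab, padding_eq_triple,
      mul_triple, mul_triple, mul_triple, mul_triple, show r + i + 1 - i = r + 1 by omega,
      Nat.add_sub_cancel, Nat.add_sub_cancel, Nat.add_sub_cancel_left]
    simp only [map_mul, map_pow, triple_wa, triple_wb, triple_wc, pow_succ', mul_assoc]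
  rw [h]
  exact mul_mem (padding_mem_elementary _ _ _ _) (mul_mem (P_mem_elementary (by decide))
    (mul_mem (A_mem_elementary (by decide)) (mul_mem (E_mem_elementary (by decide))
      (triple_mem_elementary (pow_mem (mul_mem wa_mem_closure wb_mem_closure) _)
        (mul_mem wb_mem_closure (pow_mem (mul_mem wa_mem_closure wb_mem_closure) _))))))

theorem v_eq_product (k n : ℕ) :
    v k n = P .b .a ^ k * P .c .a ^ k * A .b .a * P .a .c * (P .c .b * P .c .a) ^ (n - 1) *
      P .c .b * E .a .b := by
  have h (p : ℕ) : (P .c .b * P .c .a) ^ p = triple wa wb ((wa * wb) ^ p * wc) := by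
    induction p with
    | zero => exact subst_ext rfl rfl rfl
    | succ p ih =>
      rw [pow_succ, ih, P_eq_triple_cb, P_eq_triple_ca, mul_triple, mul_triple]
      simp only [map_mul, triple_wa, triple_wb, triple_wc, pow_succ', mul_assoc]
  have h' (p : ℕ) : (P .c .b * P .c .a) ^ p * P .c .b
      = triple wa wb ((wb * wa) ^ p * wb * wc) := by
    rw [h, P_eq_triple_cb, mul_triple, mul_pow_mul_comm]
    simp only [map_mul, triple_wa, triple_wb, triple_wc, mul_assoc]
  rw [mul_assoc _ (_ ^ (n - 1)), h', P_ba_pow, P_ca_pow, A_eq_triple_ba, P_eq_triple_ac,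
    E_eq_triple_ab]
  simp only [mul_triple]
  simp only [map_mul, map_pow, triple_wa, triple_wb, triple_wc, mul_assoc, v]

/-! ### Extensions to the free group -/

theorem extend_of (σ : Subst) (t : Letter) :
    extend σ (FreeGroup.of t) = toFreeGroup (σ (FreeMonoid.of t)) := FreeGroup.lift_apply_of

theorem toFreeGroup_of (t : Letter) : toFreeGroup (FreeMonoid.of t) = FreeGroup.of t := rfl

theorem extend_toFreeGroup (σ : Subst) (w : Word) :
    extend σ (toFreeGroup w) = toFreeGroup (σ w) := by
  have : (extend σ).comp toFreeGroup = toFreeGroup.comp σ :=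
    FreeMonoid.hom_eq fun t => extend_of σ t
  exact DFunLike.congr_fun this w

theorem extend_mul (σ τ : Subst) : extend (σ * τ) = (extend σ).comp (extend τ) := by
  ext t
  rw [MonoidHom.comp_apply, extend_of, extend_of, extend_toFreeGroup]
  rfl

theorem extend_one : extend 1 = MonoidHom.id _ := by
  ext t
  exact extend_of 1 t

theorem bijective_of_comp_eq_id {H : Type*} [Group H] {f g : H →* H}
    (h₁ : f.comp g = MonoidHom.id H) (h₂ : g.comp f = MonoidHom.id H) : Function.Bijective f :=
  Function.bijective_iff_has_inverse.2 ⟨g, DFunLike.congr_fun h₂, DFunLike.congr_fun h₁⟩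

theorem bijective_extend_E (x y : Letter) : Function.Bijective (extend (E x y)) := by
  have h : (extend (E x y)).comp (extend (E x y)) = MonoidHom.id _ := by
    rw [← extend_mul, ← extend_one]
    congr 1
    refine FreeMonoid.hom_eq fun t => ?_
    change E x y (E x y (FreeMonoid.of t)) = FreeMonoid.of t
    rw [E_of, E_of, Equiv.swap_apply_self]
  exact bijective_of_comp_eq_id h h

theorem bijective_extend_A {x y : Letter} (h : x ≠ y) : Function.Bijective (extend (A x y)) := by
  refine bijective_of_comp_eq_id (g := FreeGroup.lift fun t =>
    if t = x then FreeGroup.of x * (FreeGroup.of y)⁻¹ else FreeGroup.of t) ?_ ?_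
  all_goals
    ext t
    by_cases ht : t = x <;> simp [extend_of, A_of, ht, h.symm, toFreeGroup_of]

theorem bijective_extend_P {x y : Letter} (h : x ≠ y) : Function.Bijective (extend (P x y)) := by
  refine bijective_of_comp_eq_id (g := FreeGroup.lift fun t =>
    if t = x then (FreeGroup.of y)⁻¹ * FreeGroup.of x else FreeGroup.of t) ?_ ?_
  all_goals
    ext t
    by_cases ht : t = x <;> simp [extend_of, P_of, ht, h.symm, toFreeGroup_of]

theorem bijective_extend_of_mem_elementary {σ : Subst} (h : σ ∈ elementary) :
    Function.Bijective (extend σ) := by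
  induction h using Submonoid.closure_induction with
  | mem σ hσ =>
    rcases hσ with ⟨x, y, _, rfl⟩ | ⟨x, y, h, rfl | rfl⟩
    · exact bijective_extend_E x y
    · exact bijective_extend_A h
    · exact bijective_extend_P h
  | one => exact extend_one ▸ Function.bijective_id
  | mul σ τ _ _ hσ hτ => exact extend_mul σ τ ▸ hσ.comp hτ

/-- An action of the free group on `ℤ` in which the image of `γ_{0,n}` fixes `0`: the letter `a`
is the translation by `n`, and the values at `b` and `c` are chosen so that `b a` fixes `0` and
`c a b a` is the translation by `1`. -/
def integerAction (n : ℕ) : FreeGroup Letter →* Equiv.Perm ℤ :=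
  FreeGroup.lift fun t => match t with
    | .a => Equiv.addRight (n : ℤ)
    | .b => Equiv.swap (-n - 1 : ℤ) (-n) * (Equiv.addRight (n : ℤ))⁻¹
    | .c => Equiv.addRight (1 : ℤ) * (Equiv.swap (-n - 1 : ℤ) (-n))⁻¹ * (Equiv.addRight (n : ℤ))⁻¹

/-- The mode `γ_{0,n}` is invertible on the abelianization, so the proof uses a nonabelian
quotient: an action on `ℤ` in which `γ_{0,n}(a)`, `γ_{0,n}(b)` and
`γ_{0,n}(c)` fix `0`, and `a` does not. -/
theorem not_bijective_extend_γ_zero {n : ℕ} (hn : 0 < n) :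
    ¬ Function.Bijective (extend (γ 0 n)) := by
  intro h
  let φ : Word →* Equiv.Perm ℤ := (integerAction n).comp toFreeGroup
  have ha : φ wa = Equiv.addRight (n : ℤ) := FreeGroup.lift_apply_of
  have hb : φ wb = Equiv.swap (-n - 1 : ℤ) (-n) * (Equiv.addRight (n : ℤ))⁻¹ :=
    FreeGroup.lift_apply_of
  have hc : φ wc = Equiv.addRight (1 : ℤ) * (Equiv.swap (-n - 1 : ℤ) (-n))⁻¹ *
      (Equiv.addRight (n : ℤ))⁻¹ := FreeGroup.lift_apply_of
  have hfix (t : Letter) : φ (γ 0 n (FreeMonoid.of t)) 0 = 0 := by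
    cases t
    · change φ (wa ^ (0 + 1) * wc) 0 = 0
      simp [ha, hc, Equiv.Perm.mul_apply, Equiv.Perm.inv_def]
    · change φ (wa ^ 0 * wb * wa) 0 = 0
      rw [map_mul, map_mul, map_pow, pow_zero, one_mul, ha, hb, inv_mul_cancel_right]
      exact Equiv.swap_apply_of_ne_of_ne (by omega) (by omega)
    · change φ ((wa ^ 0 * wc * wa ^ (0 + 1) * wb * wa) ^ (n - 1) *
        (wa ^ 0 * wc * wa ^ (0 + 1) * wb)) 0 = 0
      have hper : φ (wa ^ 0 * wc * wa ^ (0 + 1) * wb * wa) = Equiv.addRight (1 : ℤ) := by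
        simp only [map_mul, map_pow, ha, hb, hc]
        group
      have hlast : φ (wa ^ 0 * wc * wa ^ (0 + 1) * wb)
          = Equiv.addRight (1 : ℤ) * (Equiv.addRight (n : ℤ))⁻¹ := by
        rw [← hper, map_mul _ _ wa, ha, mul_inv_cancel_right]
      rw [map_mul, map_pow, hper, hlast, ← mul_assoc, ← pow_succ, Nat.sub_add_cancel hn]
      simp [Equiv.Perm.mul_apply, Equiv.Perm.inv_def]
  have hall (g : FreeGroup Letter) : integerAction n (extend (γ 0 n) g) 0 = 0 := by
    have hle : (((integerAction n).comp (extend (γ 0 n))).range : Subgroup (Equiv.Perm ℤ)) ≤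
        MulAction.stabilizer (Equiv.Perm ℤ) (0 : ℤ) := by
      rw [MonoidHom.range_eq_map, ← FreeGroup.closure_range_of, MonoidHom.map_closure,
        Subgroup.closure_le]
      rintro _ ⟨_, ⟨t, rfl⟩, rfl⟩
      change integerAction n (extend (γ 0 n) (FreeGroup.of t)) 0 = 0
      rw [extend_of]
      exact hfix t
    exact hle ⟨g, rfl⟩
  -- The letter `a` moves `0`, so it does not lie in the image.
  obtain ⟨g, hg⟩ := h.2 (toFreeGroup wa)
  have h0 := hall g
  rw [hg] at h0
  have h0 : φ wa 0 = 0 := h0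
  rw [ha] at h0
  have h0 : (0 : ℤ) + n = 0 := h0
  omega

theorem goodRow_eq {k n l : ℕ} (hl : l ≤ k) :
    goodRow k n l = padding (k - l) (k - l) l l * γ 0 n := by
  obtain ⟨r, rfl⟩ : ∃ t, k = t + l := ⟨k - l, by omega⟩
  rw [goodRow, padding_eq_triple, γ, mul_triple]
  simp only [map_mul, map_pow, triple_wa, triple_wb, triple_wc, pow_zero, one_mul, zero_add,
    pow_one, Nat.add_sub_cancel, mul_assoc]

theorem isGood_goodRow {k n l : ℕ} (hn : 0 < n) (hl : l ≤ k) : IsGood (goodRow k n l) := by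
  refine ⟨isPWWF_goodRow hn hl, fun h => not_bijective_extend_γ_zero hn ?_⟩
  have h := h.2
  rw [goodRow_eq hl, extend_mul] at h
  exact (Function.Bijective.of_comp_iff'
    (bijective_extend_of_mem_elementary (padding_mem_elementary _ _ _ _)) _).1 h

/-! ### Words in the image of a production -/

/-- The production `P_{xy}` is the mirror image of `A_{xy}`. -/
theorem P_eq_reverse (x y : Letter) (w : Word) : P x y w = (A x y w.reverse).reverse := by
  induction w using FreeMonoid.inductionOn' with
  | one => rfl
  | of_mul t w ih =>
    rw [map_mul, FreeMonoid.reverse_mul, map_mul, FreeMonoid.reverse_mul, ← ih,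
      FreeMonoid.reverse_of, P_of, A_of]
    split_ifs <;> simp [FreeMonoid.reverse_mul]

theorem of_mul_injective {s t : Letter} {u w : Word}
    (h : FreeMonoid.of s * u = FreeMonoid.of t * w) : s = t ∧ u = w :=
  List.cons.inj h

theorem exists_A_of_mul (x y t : Letter) (w : Word) :
    ∃ u, A x y (FreeMonoid.of t * w) = FreeMonoid.of t * u := by
  rw [map_mul, A_of]
  split_ifs with h
  · exact ⟨FreeMonoid.of y * A x y w, by rw [h, mul_assoc]⟩
  · exact ⟨_, rfl⟩

theorem A_injective (x y : Letter) : Function.Injective (A x y) := by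
  intro u
  induction u using FreeMonoid.inductionOn' with
  | one =>
    intro w h
    cases w using FreeMonoid.casesOn with
    | one => rfl
    | of_mul t w =>
      obtain ⟨u, hu⟩ := exists_A_of_mul x y t w
      rw [hu, map_one] at h
      cases h
  | of_mul s u ih =>
    intro w h
    obtain ⟨u', hu⟩ := exists_A_of_mul x y s u
    cases w using FreeMonoid.casesOn with
    | one =>
      rw [hu, map_one] at h
      cases h
    | of_mul t w =>
      obtain ⟨w', hw⟩ := exists_A_of_mul x y t w
      have hst : s = t := (of_mul_injective (hu.symm.trans (h.trans hw))).1
      subst hst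
      rw [map_mul, map_mul] at h
      rw [ih (mul_left_cancel h)]

theorem P_injective (x y : Letter) : Function.Injective (P x y) := by
  intro u w h
  rw [P_eq_reverse, P_eq_reverse] at h
  have h' := congrArg FreeMonoid.reverse h
  rw [FreeMonoid.reverse_reverse, FreeMonoid.reverse_reverse] at h'
  have h'' := congrArg FreeMonoid.reverse (A_injective x y h')
  rwa [FreeMonoid.reverse_reverse, FreeMonoid.reverse_reverse] at h''

theorem mul_left_cancel_of_injective {X f g : Subst} (hX : Function.Injective X)
    (h : X * f = X * g) : f = g :=
  MonoidHom.ext fun w => hX (DFunLike.congr_fun h w)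

theorem mem_production_apply {x y : Letter} {X : Subst} (hX : X = A x y ∨ X = P x y) (w : Word)
    (h : x ∈ X w) : y ∈ X w := by
  induction w using FreeMonoid.inductionOn' with
  | one => exact absurd h (by rw [map_one]; exact FreeMonoid.notMem_one)
  | of_mul t w ih =>
    rw [map_mul, FreeMonoid.mem_mul] at h ⊢
    rcases hX with rfl | rfl
    · rw [A_of] at h ⊢
      split_ifs at h ⊢ with ht
      · simp [FreeMonoid.mem_mul]
      · rw [FreeMonoid.mem_of] at h
        exact Or.inr (ih (h.resolve_left fun e => ht e.symm))
    · rw [P_of] at h ⊢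
      split_ifs at h ⊢ with ht
      · simp [FreeMonoid.mem_mul]
      · rw [FreeMonoid.mem_of] at h
        exact Or.inr (ih (h.resolve_left fun e => ht e.symm))

theorem P_apply_ne_of_mul {x y : Letter} (h : x ≠ y) (u w : Word) :
    P x y u ≠ FreeMonoid.of x * w := by
  intro e
  cases u using FreeMonoid.casesOn with
  | one => rw [map_one] at e; cases e
  | of_mul t u =>
    rw [map_mul, P_of] at e
    split_ifs at e with ht
    · rw [mul_assoc] at e
      exact h (of_mul_injective e).1.symm
    · exact ht (of_mul_injective e).1

theorem A_apply_ne_mul_of {x y : Letter} (h : x ≠ y) (u w : Word) :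
    A x y u ≠ w * FreeMonoid.of x := by
  intro e
  apply P_apply_ne_of_mul h u.reverse w.reverse
  rw [P_eq_reverse, FreeMonoid.reverse_reverse, e, FreeMonoid.reverse_mul, FreeMonoid.reverse_of]

/-! ### Factorizations of the good modes -/

/-- The mode `a^{p+1} c a^r | a^q b a^{s+1} || ...` obtained from `γ_{0,n}` by productions that
attach letters `a` to `b` and `c`. -/
def paddedγ (n p q r s : ℕ) : Subst := padding p q r s * γ 0 n

theorem paddedγ_eq_triple (n p q r s : ℕ) : paddedγ n p q r s =
    triple (wa ^ (p + 1) * wc * wa ^ r) (wa ^ q * wb * wa ^ (s + 1))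
      ((wa ^ p * wc * wa ^ r * wa * (wa ^ q * wb * wa ^ s) * wa) ^ (n - 1) *
        (wa ^ p * wc * wa ^ r * wa * (wa ^ q * wb * wa ^ s))) := by
  rw [paddedγ, padding_eq_triple, γ, mul_triple]
  simp only [map_mul, map_pow, triple_wa, triple_wb, triple_wc, pow_zero, one_mul, zero_add,
    pow_one, mul_assoc, pow_succ' wa p, pow_succ wa s]

theorem padding_mul_padding (p q r s p' q' r' s' : ℕ) : padding p q r s * padding p' q' r' s'
    = padding (p' + p) (q' + q) (r + r') (s + s') := by
  simp only [padding_eq_triple, mul_triple, map_mul, map_pow, triple_wa, triple_wb, triple_wc,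
    pow_add, mul_assoc]

theorem notMem_pow {t : Letter} {w : Word} (h : t ∉ w) (n : ℕ) : t ∉ w ^ n := by
  induction n with
  | zero => exact FreeMonoid.notMem_one
  | succ n ih => rw [pow_succ, FreeMonoid.mem_mul, not_or]; exact ⟨ih, h⟩

theorem wb_notMem (p r : ℕ) : Letter.b ∉ wa ^ p * wc * wa ^ r := by
  have h : Letter.b ∉ wa := by simp [wa]
  simp [FreeMonoid.mem_mul, notMem_pow h, wc]

theorem wc_notMem (p r : ℕ) : Letter.c ∉ wa ^ p * wb * wa ^ r := by
  have h : Letter.c ∉ wa := by simp [wa]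
  simp [FreeMonoid.mem_mul, notMem_pow h, wb]

/-- The only productions that can be split off on the left are those that have been put there. -/
theorem eq_padding_of_paddedγ_eq_mul {n p q r s : ℕ} {X τ : Subst} (hX : X ∈ productions)
    (h : paddedγ n p q r s = X * τ) :
    (0 < p ∧ X = padding 1 0 0 0) ∨ (0 < q ∧ X = padding 0 1 0 0) ∨
      (0 < r ∧ X = padding 0 0 1 0) ∨ (0 < s ∧ X = padding 0 0 0 1) := by
  rw [paddedγ_eq_triple] at h
  have ha : X (τ wa) = wa ^ (p + 1) * wc * wa ^ r := (DFunLike.congr_fun h wa).symm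
  have hb : X (τ wb) = wa ^ q * wb * wa ^ (s + 1) := (DFunLike.congr_fun h wb).symm
  have hc : X (τ wc) = _ := (DFunLike.congr_fun h wc).symm
  rw [triple_wc] at hc
  obtain ⟨x, y, hxy, hX⟩ := hX
  have hy (w : Word) := mem_production_apply hX w
  -- The image of `a` contains `a` and `c` but not `b`, that of `b` contains `a` and `b` but not
  -- `c`, so `y = a`.
  have hya : y = .a := by
    have ha' := hy (τ wa)
    have hb' := hy (τ wb)
    rw [ha] at ha'
    rw [hb] at hb'
    have hbn := wb_notMem (p + 1) r
    have hcn := wc_notMem q (s + 1)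
    cases x <;> cases y <;> first
      | rfl
      | exact absurd rfl hxy
      | exact absurd (ha' (by simp [FreeMonoid.mem_mul, wc, pow_succ, wa])) hbn
      | exact absurd (hb' (by simp [FreeMonoid.mem_mul, wb, pow_succ, wa])) hcn
  subst hya
  cases x
  · exact absurd rfl hxy
  · rcases hX with rfl | rfl
    · refine Or.inr (Or.inr (Or.inr ⟨Nat.pos_of_ne_zero fun hs => ?_, ?_⟩))
      · rw [hs, pow_zero, mul_one, ← mul_assoc, ← mul_assoc] at hc
        exact A_apply_ne_mul_of hxy _ _ hc
      · rw [padding_eq_triple, A_eq_triple_ba]; simp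
    · refine Or.inr (Or.inl ⟨Nat.pos_of_ne_zero fun hq => ?_, ?_⟩)
      · rw [hq, pow_zero, one_mul] at hb
        exact P_apply_ne_of_mul hxy _ _ hb
      · rw [padding_eq_triple, P_eq_triple_ba]; simp
  · rcases hX with rfl | rfl
    · refine Or.inr (Or.inr (Or.inl ⟨Nat.pos_of_ne_zero fun hr => ?_, ?_⟩))
      · rw [hr, pow_zero, mul_one] at ha
        exact A_apply_ne_mul_of hxy _ _ ha
      · rw [padding_eq_triple, A_eq_triple_ca]; simp
    · refine Or.inl ⟨Nat.pos_of_ne_zero fun hp => ?_, ?_⟩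
      · rw [hp, pow_zero, one_mul] at hc
        rcases Nat.eq_zero_or_pos (n - 1) with h0 | h0
        · rw [h0, pow_zero, one_mul] at hc
          simp only [mul_assoc] at hc
          exact P_apply_ne_of_mul hxy _ _ hc
        · obtain ⟨t, ht⟩ : ∃ t, n - 1 = t + 1 := ⟨n - 1 - 1, by omega⟩
          rw [ht, pow_succ'] at hc
          simp only [mul_assoc] at hc
          exact P_apply_ne_of_mul hxy _ _ hc
      · rw [padding_eq_triple, P_eq_triple_ca]; simp

theorem injective_of_mem_productions {X : Subst} (hX : X ∈ productions) :
    Function.Injective X := by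
  obtain ⟨x, y, -, rfl | rfl⟩ := hX
  · exact A_injective x y
  · exact P_injective x y

theorem γ_zero_ne_production_mul (n : ℕ) {X : Subst} (hX : X ∈ productions) (τ : Subst) :
    γ 0 n ≠ X * τ := by
  intro h
  have h1 : paddedγ n 0 0 0 0 = γ 0 n := by
    rw [paddedγ, show padding 0 0 0 0 = 1 from subst_ext rfl rfl rfl, one_mul]
  rcases eq_padding_of_paddedγ_eq_mul hX (h1.trans h) with h | h | h | h <;>
    exact absurd h.1 (lt_irrefl 0)

theorem exists_padding_of_paddedγ_eq_mul {n : ℕ} {F : Subst}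
    (hF : F ∈ Submonoid.closure productions) {τ : Subst} {p q r s : ℕ}
    (h : paddedγ n p q r s = F * τ) :
    ∃ p' q' r' s', p' ≤ p ∧ q' ≤ q ∧ r' ≤ r ∧ s' ≤ s ∧ F = padding p' q' r' s' ∧
      τ = paddedγ n (p - p') (q - q') (r - r') (s - s') := by
  induction hF using Submonoid.closure_induction_left generalizing p q r s with
  | one =>
    exact ⟨0, 0, 0, 0, by omega, by omega, by omega, by omega, subst_ext rfl rfl rfl,
      (h.trans (one_mul τ)).symm⟩
  | mul_left X hX F _ ih =>
    rw [mul_assoc] at h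
    -- A production `X = padding d e f g` put there can be cancelled.
    have step {d e f g : ℕ} (hXd : X = padding d e f g) (hd : d ≤ p) (he : e ≤ q) (hf : f ≤ r)
        (hg : g ≤ s) : ∃ p' q' r' s', p' ≤ p ∧ q' ≤ q ∧ r' ≤ r ∧ s' ≤ s ∧
          X * F = padding p' q' r' s' ∧
          τ = paddedγ n (p - p') (q - q') (r - r') (s - s') := by
      have h' : paddedγ n (p - d) (q - e) (r - f) (s - g) = F * τ := by
        refine mul_left_cancel_of_injective (injective_of_mem_productions hX) (h ▸ ?_)
        rw [hXd, paddedγ, paddedγ, ← mul_assoc, padding_mul_padding, Nat.sub_add_cancel hd,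
          Nat.sub_add_cancel he, Nat.add_sub_cancel' hf, Nat.add_sub_cancel' hg]
      obtain ⟨p', q', r', s', hp, hq, hr, hs, hF, hτ⟩ := ih h'
      refine ⟨p' + d, q' + e, f + r', g + s', by omega, by omega, by omega, by omega, ?_, ?_⟩
      · rw [hXd, hF, padding_mul_padding]
      · rw [hτ]
        congr 1 <;> omega
    rcases eq_padding_of_paddedγ_eq_mul hX h with ⟨h0, hX'⟩ | ⟨h0, hX'⟩ | ⟨h0, hX'⟩ | ⟨h0, hX'⟩
    · exact step hX' h0 (by omega) (by omega) (by omega)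
    · exact step hX' (by omega) h0 (by omega) (by omega)
    · exact step hX' (by omega) (by omega) h0 (by omega)
    · exact step hX' (by omega) (by omega) (by omega) h0

/-! ### The portrait of the conjugation class -/

theorem conj_v_mod {k n : ℕ} (hn : 0 < n) (j : ℕ) :
    conj (v k n) (j % size k n) = conj (v k n) j := by
  rw [← length_modeWord_v k n hn, conj_mod]

/-- The indices before `bad*` are those of the rows `rowB`, `rowC` and `rowB'`. -/
theorem conj_v_isMorphic {k n j : ℕ} (hn : 0 < n) (hj : j < 2 * n * (k + 2) + k) :
    IsMorphic (conj (v k n) j) ∧ conj (v k n) j ∈ elementary := by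
  suffices h : IsPWWF (conj (v k n) j) ∧ conj (v k n) j ∈ elementary from
    ⟨⟨h.1, bijective_extend_of_mem_elementary h.2⟩, h.2⟩
  obtain ⟨t, i, hi, hji⟩ : ∃ t i, i < k + 2 ∧ j + 1 = t * (k + 2) + i :=
    ⟨(j + 1) / (k + 2), (j + 1) % (k + 2), Nat.mod_lt _ (by omega),
      (Nat.div_add_mod' (j + 1) (k + 2)).symm⟩
  have ht : t ≤ 2 * n := by
    by_contra! h
    have := Nat.mul_le_mul_right (k + 2) h
    rw [Nat.succ_mul] at this
    omega
  rcases Nat.even_or_odd' t with ⟨m, rfl | rfl⟩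
  · have hjm : j = 2 * m * (k + 2) + i - 1 := by omega
    by_cases hrow : m < n ∧ 1 ≤ i
    · rw [hjm, conj_v_rowB hrow.1 hrow.2 (by omega)]
      exact ⟨isPWWF_rowB hrow.1 hrow.2 (by omega), rowB_mem_elementary hrow.1 hrow.2 (by omega)⟩
    · have hm : 1 ≤ m := by
        by_contra! h
        obtain rfl : m = 0 := by omega
        omega
      have hik : i ≤ k := by
        by_contra! h
        obtain rfl : m = n := by omega
        omega
      rw [hjm, conj_v_rowB' hm (by omega) hik]
      exact ⟨isPWWF_rowB' hm (by omega) hik, rowB'_mem_elementary hm (by omega) hik⟩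
  · have hjm : j = (2 * m + 1) * (k + 2) + i - 1 := by omega
    have hm : m < n := by omega
    rw [hjm, conj_v_rowC hm (by omega)]
    exact ⟨isPWWF_rowC hm (by omega), rowC_mem_elementary hm (by omega)⟩

theorem conj_v_isGood {k n j : ℕ} (hn : 0 < n) (h₁ : 2 * n * (k + 2) + k < j)
    (h₂ : j < 2 * n * (k + 2) + 2 * k + 2) : IsGood (conj (v k n) j) := by
  obtain ⟨l, rfl⟩ : ∃ l, j = 2 * n * (k + 2) + k + 1 + l :=
    ⟨j - (2 * n * (k + 2) + k + 1), by omega⟩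
  rw [conj_v_goodRow hn (by omega)]
  exact isGood_goodRow hn (by omega)

theorem isBad_conj_v_iff {k n : ℕ} (hn : 0 < n) (j : ℕ) :
    IsBad (conj (v k n) j) ↔ conj (v k n) j = badStar k n ∨ conj (v k n) j = badStarStar k n := by
  constructor
  · intro h
    rw [← conj_v_mod hn] at h ⊢
    have hlt : j % size k n < 2 * n * (k + 2) + 2 * k + 3 :=
      size_eq k n ▸ Nat.mod_lt _ (by rw [size_eq]; omega)
    generalize j % size k n = i at *
    rcases lt_trichotomy i (2 * n * (k + 2) + k) with h₁ | rfl | h₁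
    · exact absurd (conj_v_isMorphic hn h₁).1.1 h
    · exact Or.inl (conj_v_badStar hn)
    · rcases (show i ≤ 2 * n * (k + 2) + 2 * k + 2 by omega).lt_or_eq with h₂ | rfl
      · exact absurd (conj_v_isGood hn h₁ h₂).1 h
      · exact Or.inr (conj_v_badStarStar hn)
  · rintro (h | h) <;> rw [h]
    · exact fun hP => (isBadStar_badStar hn).2.2 hP.2.2
    · exact fun hP => (isBadStarStar_badStarStar hn).1 hP.1

theorem badStar_ne_badStarStar {k n : ℕ} (hn : 0 < n) : badStar k n ≠ badStarStar k n :=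
  fun h => (isBadStarStar_badStarStar hn).1 (h ▸ (isBadStar_badStar hn).1)

end PWWF

/-- The full portrait of the conjugation class of `v_{k,n}`. -/
theorem mainTheorem1 (k n : ℕ) (hn : 0 < n) :
    -- The letter-by-letter conjugates form a cycle of `size k n` pairwise distinct modes.
    ((PWWF.modeWord (PWWF.v k n)).length = PWWF.size k n ∧
      PWWF.conj (PWWF.v k n) 0 = PWWF.v k n ∧
      (∀ j, PWWF.conj (PWWF.v k n) (j + PWWF.size k n) = PWWF.conj (PWWF.v k n) j) ∧
      Set.InjOn (PWWF.conj (PWWF.v k n)) (Set.Iio (PWWF.size k n))) ∧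
    -- The table: the morphic rows, bad*, the good rows, bad**.
    ((∀ m i, m < n → 1 ≤ i → i ≤ k + 1 →
        PWWF.conj (PWWF.v k n) (2 * m * (k + 2) + i - 1) = PWWF.rowB k n m i) ∧
      (∀ m i, m < n → i ≤ k + 1 →
        PWWF.conj (PWWF.v k n) ((2 * m + 1) * (k + 2) + i - 1) = PWWF.rowC k n m i) ∧
      (∀ m i, 1 ≤ m → m ≤ n → i ≤ k →
        PWWF.conj (PWWF.v k n) (2 * m * (k + 2) + i - 1) = PWWF.rowB' k n m i) ∧
      PWWF.conj (PWWF.v k n) (2 * n * (k + 2) + k) = PWWF.badStar k n ∧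
      (∀ l, l ≤ k →
        PWWF.conj (PWWF.v k n) (2 * n * (k + 2) + k + 1 + l) = PWWF.goodRow k n l) ∧
      PWWF.conj (PWWF.v k n) (2 * n * (k + 2) + 2 * k + 2) = PWWF.badStarStar k n ∧
      PWWF.size k n = 2 * n * (k + 2) + 2 * k + 3) ∧
    -- Exactly two conjugates are bad, with the projections that bad* and bad** name.
    (PWWF.badStar k n ≠ PWWF.badStarStar k n ∧
      (∀ j, PWWF.IsBad (PWWF.conj (PWWF.v k n) j) ↔
        PWWF.conj (PWWF.v k n) j = PWWF.badStar k n ∨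
          PWWF.conj (PWWF.v k n) j = PWWF.badStarStar k n) ∧
      PWWF.IsBadStar (PWWF.badStar k n) ∧
      PWWF.IsBadStarStar (PWWF.badStarStar k n)) ∧
    -- The segment from bad** to bad* is morphic, by products of `E`, `A` and `P`.
    ((∀ j, j < 2 * n * (k + 2) + k →
        PWWF.IsMorphic (PWWF.conj (PWWF.v k n) j) ∧
          PWWF.conj (PWWF.v k n) j ∈
            Submonoid.closure (PWWF.transpositions ∪ PWWF.productions)) ∧
      PWWF.v k n =
        PWWF.P .b .a ^ k * PWWF.P .c .a ^ k * PWWF.A .b .a * PWWF.P .a .c *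
          (PWWF.P .c .b * PWWF.P .c .a) ^ (n - 1) * PWWF.P .c .b * PWWF.E .a .b) ∧
    -- The segment from bad* to bad** is good, and not morphic.
    (∀ j, 2 * n * (k + 2) + k < j → j < 2 * n * (k + 2) + 2 * k + 2 →
      PWWF.IsGood (PWWF.conj (PWWF.v k n) j)) ∧
    -- The modes marked with stars: the special standard projections.
    (PWWF.IsSpecialStandard (PWWF.apotomic (PWWF.v k n)) ∧
      PWWF.IsSpecialStandard (PWWF.apoSyntonic (PWWF.v k n)) ∧
      PWWF.goodRow k n 0 = PWWF.γ k n ∧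
      PWWF.IsSpecialStandard (PWWF.syntonic (PWWF.γ k n))) ∧
    -- All good modes come from `γ_{0,n}`, which no production generates, and in no other way.
    ((∀ l, l ≤ k → PWWF.goodRow k n l = PWWF.padding (k - l) (k - l) l l * PWWF.γ 0 n) ∧
      (∀ X ∈ PWWF.productions, ∀ τ : PWWF.Subst, PWWF.γ 0 n ≠ X * τ) ∧
      (∀ l, l ≤ k → ∀ F ∈ Submonoid.closure PWWF.productions, ∀ τ : PWWF.Subst,
        PWWF.goodRow k n l = F * τ →
          ∃ p q r s : ℕ, p ≤ k - l ∧ q ≤ k - l ∧ r ≤ l ∧ s ≤ l ∧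
            F = PWWF.padding p q r s ∧
            τ = PWWF.padding (k - l - p) (k - l - q) (l - r) (l - s) * PWWF.γ 0 n)) := by
  refine ⟨⟨PWWF.length_modeWord_v k n hn, ?_, ?_, PWWF.conj_v_injOn hn⟩,
    ⟨fun m i => PWWF.conj_v_rowB, fun m i => PWWF.conj_v_rowC, fun m i => PWWF.conj_v_rowB',
      PWWF.conj_v_badStar hn, fun l => PWWF.conj_v_goodRow hn, PWWF.conj_v_badStarStar hn,
      PWWF.size_eq k n⟩,
    ⟨PWWF.badStar_ne_badStarStar hn, PWWF.isBad_conj_v_iff hn, PWWF.isBadStar_badStar hn,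
      PWWF.isBadStarStar_badStarStar hn⟩,
    ⟨fun j => PWWF.conj_v_isMorphic hn, PWWF.v_eq_product k n⟩,
    fun j => PWWF.conj_v_isGood hn,
    ⟨PWWF.isSpecialStandard_apotomic_v hn, PWWF.isSpecialStandard_apoSyntonic_v hn,
      PWWF.goodRow_zero k n, PWWF.isSpecialStandard_syntonic_γ hn⟩,
    fun l => PWWF.goodRow_eq, fun X hX τ => PWWF.γ_zero_ne_production_mul n hX τ, ?_⟩
  · have h := PWWF.conj_v_rowB (k := k) hn le_rfl (Nat.le_add_left 1 k)
    rw [PWWF.v_eq_rowB hn] at h ⊢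
    simpa using h
  · intro j
    rw [← PWWF.conj_v_mod hn, Nat.add_mod_right, PWWF.conj_v_mod hn]
  · intro l hl F hF τ h
    rw [PWWF.goodRow_eq hl] at h
    obtain ⟨p, q, r, s, hp, hq, hr, hs, hF, hτ⟩ := PWWF.exists_padding_of_paddedγ_eq_mul hF h
    exact ⟨p, q, r, s, hp, hq, hr, hs, hF, hτ⟩
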